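/- Let $E_8$ be the $E_8$ root lattice, $O(E_8)$ its isometry group, and call $h\in O(E_8)$ rootless if $(h-1)E_8$ contains no root, i.e. no vector of norm $2$. For $n\ge 1$ let $A_n=\{x\in\mathbb Z^{n+1}:\sum_i x_i=0\}$, let $h_{A_n}$ be the isometry of $A_n$ given by the cyclic permutation of the $n+1$ coordinates, and let $D_4=\{x\in\mathbb Z^4:\sum_i x_i \text{ even}\}$. Isometric embeddings of $Q:=A_3\perp A_3\perp A_1\perp A_1$ in $E_8$ exist. Theorem. Let $h\in O(E_8)$ be rootless of order $4$ and put $J=\operatorname{Ker}(h^2+1)\subseteq E_8$. Then $J\cong D_4$ or $J\cong E_8$ (as lattices). (1) Suppose $J\cong D_4$, and identify $Q$ with a sublattice of $E_8$ by any isometric embedding. Then the isometries $h_{A_3}\oplus h_{A_3}\oplus h_{A_1}\oplus h_{A_1}$ and $h_{A_3}\oplus h_{A_3}\oplus h_{A_1}\oplus \mathrm{id}_{A_1}$ of $Q$ extend (uniquely, as $Q$ has rank $8$) to elements of $O(E_8)$, and $h$ is conjugate in $O(E_8)$ to one of these two elements. (2) If $J\cong E_8$, then $h$ is fixed point free (that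 is, $hx=x$ only for $x=0$) and $h^2=-1$ on $E_8$. Moreover, the rootless elements $h\in O(E_8)$ of order $4$ with $J\cong E_8$ are exactly the $h\in O(E_8)$ with $h^2=-1$, and they form a single conjugacy class of $O(E_8)$. -/

import Mathlib

namespace RootlessE8

open LinearMap (BilinForm)

/-- The group `O(L)` of isometries of a lattice `L = (M, B)`: all `ℤ`-linear automorphisms of `M`
that preserve the form `B`. -/
def isometryGroup {M : Type*} [AddCommGroup M] (B : BilinForm ℤ M) :
    Subgroup (M ≃ₗ[ℤ] M) where
  carrier := {g | ∀ x y, B (g x) (g y) = B x y}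
  one_mem' := fun _ _ => rfl
  mul_mem' := by
    intro a b ha hb x y
    simp only [LinearEquiv.mul_apply]
    rw [ha, hb]
  inv_mem' := by
    intro a ha x y
    have h := ha (a⁻¹ x) (a⁻¹ y)
    rw [← LinearEquiv.mul_apply, ← LinearEquiv.mul_apply, mul_inv_cancel] at h
    exact h.symm

/-- The orthogonal direct sum of two lattices. -/
def orthogonalSum {M N : Type*} [AddCommGroup M] [AddCommGroup N]
    (B : BilinForm ℤ M) (C : BilinForm ℤ N) : BilinForm ℤ (M × N) :=
  B.comp (LinearMap.fst ℤ M N) (LinearMap.fst ℤ M N) +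
    C.comp (LinearMap.snd ℤ M N) (LinearMap.snd ℤ M N)

/-- The standard form `∑ xᵢ yᵢ` on `ℤⁿ`. -/
def dotForm (n : ℕ) : BilinForm ℤ (Fin n → ℤ) :=
  Matrix.toBilin' (1 : Matrix (Fin n) (Fin n) ℤ)

/-- The form of the `E₈` lattice: `ℤ⁸`, the coordinates being those with respect to a basis of
simple roots, with the `E₈` Cartan matrix as Gram matrix. -/
def E8Form : BilinForm ℤ (Fin 8 → ℤ) :=
  Matrix.toBilin' CartanMatrix.E₈

/-- The group `O(E₈)`. -/
abbrev OE8 : Type := isometryGroup E8Form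

/-- The root lattice `A_n`: the vectors of coordinate sum `0` in `ℤ^(n+1)`. -/
def latticeA (n : ℕ) : Submodule ℤ (Fin (n + 1) → ℤ) where
  carrier := {x | ∑ i, x i = 0}
  zero_mem' := by simp
  add_mem' := by
    intro a b ha hb
    simp only [Set.mem_ofPred_eq] at ha hb ⊢
    simp [Finset.sum_add_distrib, ha, hb]
  smul_mem' := by
    intro c a ha
    simp only [Set.mem_ofPred_eq] at ha ⊢
    simp [← Finset.mul_sum, ha]

/-- The form of `A_n`. -/
def formA (n : ℕ) : BilinForm ℤ (latticeA n) :=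
  (dotForm (n + 1)).restrict (latticeA n)

/-- The root lattice `D_n`: the vectors of even coordinate sum in `ℤⁿ`. -/
def latticeD (n : ℕ) : Submodule ℤ (Fin n → ℤ) where
  carrier := {x | Even (∑ i, x i)}
  zero_mem' := by simp
  add_mem' := by
    intro a b ha hb
    simp only [Set.mem_ofPred_eq] at ha hb ⊢
    simpa [Finset.sum_add_distrib] using ha.add hb
  smul_mem' := by
    intro c a ha
    simp only [Set.mem_ofPred_eq] at ha ⊢
    simpa [← Finset.mul_sum] using ha.mul_left c

/-- The form of `D_n`. -/
def formD (n : ℕ) : BilinForm ℤ (latticeD n) :=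
  (dotForm n).restrict (latticeD n)

/-- `h_{A_n}`: the cyclic permutation of the `n + 1` coordinates, acting on `A_n`. -/
def hA (n : ℕ) : latticeA n →ₗ[ℤ] latticeA n :=
  (LinearMap.funLeft ℤ ℤ (finRotate (n + 1))).restrict (by
    intro x hx
    change ∑ i, x (finRotate (n + 1) i) = 0
    rw [Equiv.sum_comp (finRotate (n + 1)) x]
    exact hx)

/-- The lattice `A₃ ⊥ A₃ ⊥ A₁ ⊥ A₁`. -/
abbrev Q : Type := (latticeA 3 × latticeA 3) × (latticeA 1 × latticeA 1)

/-- The form of `A₃ ⊥ A₃ ⊥ A₁ ⊥ A₁`. -/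
def formQ : BilinForm ℤ Q :=
  orthogonalSum (orthogonalSum (formA 3) (formA 3)) (orthogonalSum (formA 1) (formA 1))

/-- `h_{A₃} ⊕ h_{A₃} ⊕ h_{A₁} ⊕ h_{A₁}` on `A₃ ⊥ A₃ ⊥ A₁ ⊥ A₁`. -/
def hQ₁ : Q →ₗ[ℤ] Q :=
  ((hA 3).prodMap (hA 3)).prodMap ((hA 1).prodMap (hA 1))

/-- `h_{A₃} ⊕ h_{A₃} ⊕ h_{A₁} ⊕ id_{A₁}` on `A₃ ⊥ A₃ ⊥ A₁ ⊥ A₁`. -/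
def hQ₂ : Q →ₗ[ℤ] Q :=
  ((hA 3).prodMap (hA 3)).prodMap ((hA 1).prodMap LinearMap.id)

/-- `g ∈ O(E₈)` extends the map `k` of the sublattice `φ(Q)`, where `Q = A₃ ⊥ A₃ ⊥ A₁ ⊥ A₁` is
identified with a sublattice of `E₈` through the isometric embedding `φ`. As `φ(Q)` has rank `8`,
there is at most one such `g`. -/
def Extends (φ : formQ →bᵢ E8Form) (k : Q →ₗ[ℤ] Q) (g : OE8) : Prop :=
  ∀ x : Q, g.1 (φ x) = φ (k x)

/-- `h` is rootless: `(h - 1)E₈` contains no root, a root being a vector of norm `2`. -/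
def IsRootless (h : OE8) : Prop :=
  ∀ v ∈ LinearMap.range (h.1.toLinearMap - LinearMap.id), E8Form v v ≠ 2

/-- The sublattice `J = Ker(h² + 1)` of `E₈`. -/
def J (h : OE8) : Submodule ℤ (Fin 8 → ℤ) :=
  LinearMap.ker (h.1.toLinearMap ∘ₗ h.1.toLinearMap + LinearMap.id)

/-- `J ≅ D₄`, as lattices. -/
def JIsD4 (h : OE8) : Prop := (E8Form.restrict (J h)).Equivalent (formD 4)

/-- `J ≅ E₈`, as lattices. -/
def JIsE8 (h : OE8) : Prop := (E8Form.restrict (J h)).Equivalent E8Form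

end RootlessE8

namespace RootlessE8

open LinearMap (BilinForm)

/-! ### The form of `E₈` -/

/-! Any `h` with `h ^ 4 = 1` can be made to permute a fixed orthogonal frame up to sign, and
rootlessness then leaves three signed permutations.

`E₈ / 2E₈` has 135 nonzero singular vectors. This number is odd, so an isometry of 2-power order
fixes one of them. The norm 4 vectors in such a class are `±` the members of an orthogonal frame,
and reflections move every such class to that of `stdFrame`; hence `h` is conjugate to a monomial
isometry (`exists_conj_monomial`).

In coordinates with respect to the frame, `E₈` consists of the integer vectors whose entries have
equal parity and sum divisible by 4, with norm a quarter of the sum of squares. Half-sums of two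
frame vectors show that a rootless `h` of order 4 has an involutive underlying permutation, with
sign `-1` at each fixed point. A vector with all coordinates `±1` yields a member of `(h - 1)E₈` of
norm `f + n`, where `f` counts the fixed points and `n` the two-cycles on which `h ^ 2 = -1`. As
this norm is even and not 2, and `f + 2n + 2p = 8` with `p` the number of remaining two-cycles, `(n,
f, p)` is `(4, 0, 0)`, `(2, 4, 0)` or `(2, 2, 1)` (`IsMonomial.card_cases`). Each pattern is a
single conjugacy class (`HasPattern.isConj`); the first has `h ^ 2 = -1`, the other two have `J ≅
D₄`.

The two isometries of `Q` are products of reflections in roots, so they extend to `E₈`. A norm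
estimate shows that the extensions are rootless of order 4, so the classification applies to them as
well; the presence or absence of a nonzero fixed vector decides which `D₄` pattern each one has. -/

theorem E8Form_apply (x y : Fin 8 → ℤ) :
    E8Form x y = 2 * (x 0 * y 0 + x 1 * y 1 + x 2 * y 2 + x 3 * y 3 + x 4 * y 4 + x 5 * y 5
      + x 6 * y 6 + x 7 * y 7) - (x 0 * y 2 + x 2 * y 0) - (x 1 * y 3 + x 3 * y 1)
      - (x 2 * y 3 + x 3 * y 2) - (x 3 * y 4 + x 4 * y 3) - (x 4 * y 5 + x 5 * y 4)
      - (x 5 * y 6 + x 6 * y 5) - (x 6 * y 7 + x 7 * y 6) := by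
  rw [E8Form, Matrix.toBilin'_apply]
  simp only [Fin.sum_univ_eight]
  simp [CartanMatrix.E₈]
  ring

theorem E8Form_comm (x y : Fin 8 → ℤ) : E8Form x y = E8Form y x := by
  simp only [E8Form_apply]; ring

/-- The quadratic form `x ↦ B(x, x) / 2` of `E₈`, over an arbitrary commutative ring. -/
def quad {R : Type*} [CommRing R] (x : Fin 8 → R) : R :=
  x 0 ^ 2 + x 1 ^ 2 + x 2 ^ 2 + x 3 ^ 2 + x 4 ^ 2 + x 5 ^ 2 + x 6 ^ 2 + x 7 ^ 2
    - x 0 * x 2 - x 1 * x 3 - x 2 * x 3 - x 3 * x 4 - x 4 * x 5 - x 5 * x 6 - x 6 * x 7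

theorem E8Form_self (x : Fin 8 → ℤ) : E8Form x x = 2 * quad x := by
  rw [E8Form_apply, quad]; ring

/-- An orthogonal frame of vectors of norm `4`, all congruent modulo `2E₈`. -/
def stdFrame : Fin 8 → Fin 8 → ℤ :=
  ![![0, 1, -1, 0, 0, 0, 0, 0],
    ![0, 1, 1, 0, 0, 0, 0, 0],
    ![0, 1, 1, 2, 0, 0, 0, 0],
    ![0, 1, 1, 2, 2, 0, 0, 0],
    ![0, 1, 1, 2, 2, 2, 0, 0],
    ![0, 1, 1, 2, 2, 2, 2, 0],
    ![0, 1, 1, 2, 2, 2, 2, 2],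
    ![4, 5, 7, 10, 8, 6, 4, 2]]

/-- The inner products with the vectors of the standard frame. -/
def coord (x : Fin 8 → ℤ) (i : Fin 8) : ℤ := E8Form x (stdFrame i)

theorem coord_add (x y : Fin 8 → ℤ) (i : Fin 8) : coord (x + y) i = coord x i + coord y i := by
  simp [coord]

theorem coord_sub (x y : Fin 8 → ℤ) (i : Fin 8) : coord (x - y) i = coord x i - coord y i := by
  simp [coord]

theorem coord_neg (x : Fin 8 → ℤ) (i : Fin 8) : coord (-x) i = -coord x i := by
  simp [coord]

theorem coord_smul (n : ℤ) (x : Fin 8 → ℤ) (i : Fin 8) : coord (n • x) i = n * coord x i := by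
  simp only [coord, map_smul, LinearMap.smul_apply, smul_eq_mul]

theorem coord_apply (x : Fin 8 → ℤ) : coord x =
    ![x 0 + 2 * x 1 - 2 * x 2, -x 0 + 2 * x 1 + 2 * x 2 - 2 * x 3, -x 0 + 2 * x 3 - 2 * x 4,
      -x 0 + 2 * x 4 - 2 * x 5, -x 0 + 2 * x 5 - 2 * x 6, -x 0 + 2 * x 6 - 2 * x 7,
      -x 0 + 2 * x 7, x 0] := by
  ext i
  fin_cases i <;> simp [coord, E8Form_apply, stdFrame] <;> ring

theorem four_mul_E8Form (x y : Fin 8 → ℤ) : 4 * E8Form x y = ∑ i, coord x i * coord y i := by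
  simp only [coord_apply, Fin.sum_univ_eight, E8Form_apply]
  simp
  ring

theorem sum_coord_smul (x : Fin 8 → ℤ) : ∑ i, coord x i • stdFrame i = (4 : ℤ) • x := by
  ext j
  simp only [coord_apply, Fin.sum_univ_eight]
  fin_cases j <;> simp [stdFrame] <;> ring

theorem coord_stdFrame (i j : Fin 8) : coord (stdFrame i) j = if i = j then 4 else 0 := by
  rw [coord_apply]
  revert i j
  decide

theorem coord_injective : Function.Injective coord := by
  intro x y h
  have hx := sum_coord_smul x
  rw [h, sum_coord_smul] at hx
  exact (smul_right_injective _ (by norm_num : (4 : ℤ) ≠ 0) hx).symm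

theorem two_dvd_coord_sub (x : Fin 8 → ℤ) (i : Fin 8) : (2 : ℤ) ∣ coord x i - coord x 0 := by
  rw [coord_apply]
  fin_cases i <;> simp <;> omega

theorem four_dvd_sum_coord (x : Fin 8 → ℤ) : (4 : ℤ) ∣ ∑ i, coord x i := by
  rw [coord_apply, Fin.sum_univ_eight]
  simp
  omega

/-- Converse of the two preceding divisibilities: together they describe `E₈` completely in frame
coordinates. -/
theorem exists_coord_eq (d : Fin 8 → ℤ) (h : ∀ i, (2 : ℤ) ∣ d i - d 0)
    (hs : (4 : ℤ) ∣ ∑ i, d i) : ∃ x, coord x = d := by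
  rw [Fin.sum_univ_eight] at hs
  obtain ⟨k, hk⟩ := hs
  choose e he using h
  have he' : ∀ i, d i = d 0 + 2 * e i := fun i => by have := he i; omega
  have h0 := he' 0; have h1 := he' 1; have h2 := he' 2; have h3 := he' 3
  have h4 := he' 4; have h5 := he' 5; have h6 := he' 6; have h7 := he' 7
  -- The witness solves the linear system of `coord_apply`, starting from its last entry.
  refine ⟨![d 7, d 0 + k + 2 * e 7, d 0 + k + 3 * e 7,
    5 * d 0 + e 2 + e 3 + e 4 + e 5 + e 6 + 5 * e 7,
    4 * d 0 + e 3 + e 4 + e 5 + e 6 + 4 * e 7, 3 * d 0 + e 4 + e 5 + e 6 + 3 * e 7,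
    2 * d 0 + e 5 + e 6 + 2 * e 7, d 0 + e 6 + e 7], ?_⟩
  rw [coord_apply]
  ext i
  fin_cases i <;> simp <;> omega

theorem E8Form_self_nonneg (x : Fin 8 → ℤ) : 0 ≤ E8Form x x := by
  have h := four_mul_E8Form x x
  have : 0 ≤ ∑ i, coord x i * coord x i := Finset.sum_nonneg fun i _ => mul_self_nonneg _
  omega

theorem E8Form_self_eq_zero {x : Fin 8 → ℤ} (hx : E8Form x x = 0) : x = 0 := by
  have h := four_mul_E8Form x x
  rw [hx, mul_zero, eq_comm,
    Finset.sum_eq_zero_iff_of_nonneg fun i _ => mul_self_nonneg _] at h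
  apply coord_injective
  ext i
  have := h i (Finset.mem_univ i)
  rw [mul_self_eq_zero.1 this]
  simp [coord]

theorem eq_zero_of_E8Form_self_lt_two {x : Fin 8 → ℤ} (hx : E8Form x x < 2) : x = 0 := by
  apply E8Form_self_eq_zero
  have := E8Form_self_nonneg x
  have := E8Form_self x
  omega

/-! ### Isometries of `E₈` -/

theorem isometry_apply (g : OE8) (x y : Fin 8 → ℤ) : E8Form (g.1 x) (g.1 y) = E8Form x y :=
  g.2 x y

theorem inv_apply_self (g : OE8) (x : Fin 8 → ℤ) : (g⁻¹).1 (g.1 x) = x :=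
  g.1.symm_apply_apply x

theorem apply_inv_self (g : OE8) (x : Fin 8 → ℤ) : g.1 ((g⁻¹).1 x) = x :=
  g.1.apply_symm_apply x

theorem mul_apply' (g k : OE8) (x : Fin 8 → ℤ) : (g * k).1 x = g.1 (k.1 x) := rfl

/-- As `E₈` is unimodular, an endomorphism that preserves the form is an isometry. -/
theorem exists_isometry_eq (T : (Fin 8 → ℤ) →ₗ[ℤ] (Fin 8 → ℤ))
    (hT : ∀ x y, E8Form (T x) (T y) = E8Form x y) : ∃ g : OE8, ∀ x, g.1 x = T x := by
  have h1 : E8Form.comp T T = E8Form := LinearMap.ext₂ hT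
  have h2 := congrArg LinearMap.BilinForm.toMatrix' h1
  rw [LinearMap.BilinForm.toMatrix'_comp] at h2
  -- Since the Gram determinant is 1, this reads `det T ^ 2 = 1`.
  have h3 := congrArg Matrix.det h2
  rw [Matrix.det_mul, Matrix.det_mul, Matrix.det_transpose, E8Form,
    LinearMap.BilinForm.toMatrix'_toBilin', CartanMatrix.E₈_det, mul_one] at h3
  have h4 : IsUnit (LinearMap.toMatrix (Pi.basisFun ℤ (Fin 8)) (Pi.basisFun ℤ (Fin 8)) T).det :=
    IsUnit.of_mul_eq_one _ h3
  exact ⟨⟨LinearEquiv.ofIsUnitDet h4, hT⟩, fun x => rfl⟩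

theorem isometry_ext {g k : OE8} (h : ∀ i, g.1 (stdFrame i) = k.1 (stdFrame i)) : g = k := by
  apply Subtype.ext
  ext1 x
  apply smul_right_injective _ (by norm_num : (4 : ℤ) ≠ 0)
  simp only [← map_smul, ← sum_coord_smul, map_sum]
  exact Finset.sum_congr rfl fun i _ => by rw [map_smul, map_smul, h]

/-- The reflection in a root. -/
theorem exists_reflection (r : Fin 8 → ℤ) (hr : E8Form r r = 2) :
    ∃ g : OE8, ∀ x, g.1 x = x - E8Form x r • r := by
  let T : (Fin 8 → ℤ) →ₗ[ℤ] (Fin 8 → ℤ) := LinearMap.id - (E8Form.flip r).smulRight r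
  have hT : ∀ x, T x = x - E8Form x r • r := fun x => by simp [T]
  obtain ⟨g, hg⟩ := exists_isometry_eq T (fun x y => by
    rw [hT, hT]
    simp only [map_sub, map_smul, LinearMap.sub_apply, LinearMap.smul_apply, hr, smul_eq_mul,
      E8Form_comm r y]
    ring)
  exact ⟨g, fun x => by rw [hg, hT]⟩

/-- A tuple of vectors of `E₈` that is the image of the standard frame under an isometry, see
`IsFrame.exists_isometry`. -/
structure IsFrame (f : Fin 8 → Fin 8 → ℤ) : Prop where
  form_eq : ∀ i j, E8Form (f i) (f j) = if i = j then 4 else 0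
  congr : ∀ i, ∃ y, f i = f 0 + (2 : ℤ) • y
  sum : ∃ y, ∑ i, f i = (4 : ℤ) • y

theorem IsFrame.exists_isometry {f : Fin 8 → Fin 8 → ℤ} (hf : IsFrame f) :
    ∃ g : OE8, ∀ i, g.1 (stdFrame i) = f i := by
  obtain ⟨s, hs⟩ := hf.sum
  choose y hy using hf.congr
  -- The isometry has to send `x` to a quarter of `∑ coord x i • f i`; parity of the coordinates,
  -- the congruences between the `f i` and the condition on `∑ f i` make this integral.
  have key : ∀ x, ∃ z, ∑ i, coord x i • f i = (4 : ℤ) • z := by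
    intro x
    choose d hd using two_dvd_coord_sub x
    have hd' : ∀ i, coord x i = coord x 0 + 2 * d i := fun i => by have := hd i; omega
    obtain ⟨e, he⟩ : (2 : ℤ) ∣ ∑ i, d i := by
      have := four_dvd_sum_coord x
      simp only [Fin.sum_univ_eight] at this ⊢
      have := hd' 1; have := hd' 2; have := hd' 3; have := hd' 4; have := hd' 5
      have := hd' 6; have := hd' 7; have := hd' 0
      omega
    refine ⟨coord x 0 • s + e • f 0 + ∑ i, d i • y i, ?_⟩
    calc ∑ i, coord x i • f i = coord x 0 • ∑ i, f i + (2 : ℤ) • (∑ i, d i) • f 0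
          + (4 : ℤ) • ∑ i, d i • y i := by
          simp only [Finset.smul_sum, Finset.sum_smul, ← Finset.sum_add_distrib]
          refine Finset.sum_congr rfl fun i _ => ?_
          rw [hd' i]
          linear_combination (exp := 1) (2 * d i) • hy i
      _ = _ := by rw [hs, he]; module
  choose z hz using key
  let T : (Fin 8 → ℤ) →ₗ[ℤ] (Fin 8 → ℤ) :=
    { toFun := z
      map_add' := fun x x' => by
        apply smul_right_injective _ (by norm_num : (4 : ℤ) ≠ 0)
        simp only [smul_add, ← hz, coord_add, add_smul, Finset.sum_add_distrib]
      map_smul' := fun n x => by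
        apply smul_right_injective _ (by norm_num : (4 : ℤ) ≠ 0)
        simp only [smul_comm _ n, ← hz, coord_smul, mul_smul, Finset.smul_sum, RingHom.id_apply] }
  have hT : ∀ x, (4 : ℤ) • T x = ∑ i, coord x i • f i := fun x => (hz x).symm
  obtain ⟨g, hg⟩ := exists_isometry_eq T (fun x x' => by
    have h1 : E8Form ((4 : ℤ) • T x) ((4 : ℤ) • T x') = 4 * ∑ i, coord x i * coord x' i := by
      rw [hT, hT]
      simp only [map_sum, map_smul, LinearMap.sum_apply, LinearMap.smul_apply, hf.form_eq,
        smul_eq_mul, mul_ite, mul_zero, Finset.sum_ite_eq', Finset.mem_univ,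
        if_true, Finset.mul_sum]
      exact Finset.sum_congr rfl fun i _ => by ring
    rw [← four_mul_E8Form] at h1
    simp only [map_smul, LinearMap.smul_apply, smul_eq_mul] at h1
    omega)
  refine ⟨g, fun i => smul_right_injective _ (by norm_num : (4 : ℤ) ≠ 0) ?_⟩
  simp only [hg, hT, coord_stdFrame, ite_smul, zero_smul, Finset.sum_ite_eq, Finset.mem_univ,
    if_true]

/-! ### `E₈` modulo two -/

/-- Reduction modulo two. -/
def red (x : Fin 8 → ℤ) : Fin 8 → ZMod 2 := fun i => (x i : ZMod 2)

theorem red_add (x y : Fin 8 → ℤ) : red (x + y) = red x + red y := by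
  ext i; simp [red]

theorem red_sub (x y : Fin 8 → ℤ) : red (x - y) = red x - red y := by
  ext i; simp [red]

theorem red_smul (n : ℤ) (x : Fin 8 → ℤ) : red (n • x) = (n : ZMod 2) • red x := by
  ext i; simp [red]

theorem quad_red (x : Fin 8 → ℤ) : quad (red x) = ((quad x : ℤ) : ZMod 2) := by
  simp [quad, red]

theorem red_eq_iff {x y : Fin 8 → ℤ} : red x = red y ↔ ∃ z, x = y + (2 : ℤ) • z := by
  constructor
  · intro h
    have h' : ∀ i, (2 : ℤ) ∣ x i - y i := fun i => by
      have := (ZMod.intCast_eq_intCast_iff_dvd_sub (y i) (x i) 2).1 (congrFun h i).symm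
      exact_mod_cast this
    choose z hz using h'
    exact ⟨z, by ext i; have := hz i; simp only [Pi.add_apply, Pi.smul_apply, smul_eq_mul]; omega⟩
  · rintro ⟨z, rfl⟩
    rw [red_add, red_smul, show ((2 : ℤ) : ZMod 2) = 0 from rfl, zero_smul, add_zero]

theorem red_apply_eq {x y : Fin 8 → ℤ} (h : red x = red y) (g : OE8) :
    red (g.1 x) = red (g.1 y) := by
  obtain ⟨z, rfl⟩ := red_eq_iff.1 h
  exact red_eq_iff.2 ⟨g.1 z, by rw [map_add, map_smul]⟩

theorem red_apply_ne_zero {x : Fin 8 → ℤ} (h : red x ≠ 0) (g : OE8) : red (g.1 x) ≠ 0 := by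
  intro h0
  apply h
  have h0' : red (g.1 x) = red (g.1 0) := by
    rw [h0, map_zero]; ext i; simp [red]
  have := red_apply_eq h0' g⁻¹
  rw [inv_apply_self, inv_apply_self] at this
  rw [this]; ext i; simp [red]

theorem quad_apply (g : OE8) (x : Fin 8 → ℤ) : quad (g.1 x) = quad x := by
  have := isometry_apply g x x
  rw [E8Form_self, E8Form_self] at this
  omega

theorem quad_add (x y : Fin 8 → ℤ) : quad (x + y) = quad x + quad y + E8Form x y := by
  have h := E8Form_self (x + y)
  simp only [map_add, LinearMap.add_apply, E8Form_self, E8Form_comm y x] at h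
  omega

/-- The nonzero singular vectors of `E₈ / 2E₈`. -/
abbrev Singular : Type := {v : Fin 8 → ZMod 2 // v ≠ 0 ∧ quad v = 0}

-- What matters is that 135 is odd.
set_option maxRecDepth 10000 in
theorem card_singular : Fintype.card Singular = 135 := by
  decide +kernel

/-- Roots whose reflections suffice to move every nonzero singular vector of `E₈ / 2E₈` to the
class of the standard frame, decreasing `weight` in each step. -/
def descentRoot : Fin 12 → Fin 8 → ℤ :=
  ![![0, 0, 0, 0, 0, 0, 0, 1], ![0, 0, 0, 0, 0, 1, 0, 0], ![0, 0, 0, 0, 0, 0, 1, 1],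
    ![0, 0, 0, 0, 0, 1, 1, 0], ![0, 0, 1, 1, 1, 1, 0, 0], ![1, 0, 0, 0, 0, 0, 0, 0],
    ![0, 1, 0, 1, 0, 0, 0, 0], ![0, 0, 0, 0, 1, 1, 0, 0], ![0, 0, 0, 1, 0, 0, 0, 0],
    ![0, 0, 0, 1, 1, 0, 0, 0], ![0, 0, 1, 0, 0, 0, 0, 0], ![1, 0, 1, 1, 1, 0, 0, 0]]

theorem quad_descentRoot (k : Fin 12) : quad (descentRoot k) = 1 := by
  revert k; decide

/-- A weight on `E₈ / 2E₈`. -/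
def weight (v : Fin 8 → ZMod 2) : ℕ :=
  2 * (v 0).val + (3 - 3 * (v 2).val) + (v 3).val + 7 * (v 4).val + 8 * (v 5).val
    + 9 * (v 6).val + 10 * (v 7).val

theorem exists_descent : ∀ v : Fin 8 → ZMod 2, v ≠ 0 → quad v = 0 → v ≠ red (stdFrame 0) →
    ∃ k, quad (v + red (descentRoot k)) = 0 ∧ v + red (descentRoot k) ≠ 0 ∧
      weight (v + red (descentRoot k)) < weight v := by
  decide +kernel

theorem exists_red_apply_eq (x : Fin 8 → ℤ) (h0 : red x ≠ 0) (hq : quad (red x) = 0) :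
    ∃ g : OE8, red (g.1 x) = red (stdFrame 0) := by
  induction hn : weight (red x) using Nat.strong_induction_on generalizing x with
  | _ n ih =>
    by_cases hx : red x = red (stdFrame 0)
    · exact ⟨1, hx⟩
    obtain ⟨k, hk1, hk2, hk3⟩ := exists_descent _ h0 hq hx
    have hr : E8Form (descentRoot k) (descentRoot k) = 2 := by
      rw [E8Form_self, quad_descentRoot, mul_one]
    obtain ⟨s, hs⟩ := exists_reflection _ hr
    have hred : red (s.1 x) = red x + red (descentRoot k) := by
      rw [← red_add, quad_red, quad_add, quad_descentRoot] at hk1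
      rw [quad_red] at hq
      rw [hs, red_sub, red_smul]
      push_cast [hq] at hk1
      -- Both `x` and `x + r` are singular modulo 2 while `quad r = 1`, so `(x, r)` is odd and the
      -- reflection adds `r` modulo 2.
      have : ((E8Form x (descentRoot k) : ℤ) : ZMod 2) = 1 := by
        generalize ((E8Form x (descentRoot k) : ℤ) : ZMod 2) = b at hk1
        revert hk1; revert b; decide
      rw [this, one_smul, CharTwo.sub_eq_add]
    obtain ⟨g, hg⟩ := ih _ (by rw [← hn, hred]; exact hk3) (s.1 x) (hred ▸ hk2)
      (hred ▸ hk1) rfl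
    exact ⟨g * s, hg⟩

/-- A permutation of 2-power order of an odd number of singular vectors has a fixed point. -/
theorem exists_red_fixed (h : OE8) (h4 : h ^ 4 = 1) :
    ∃ x, red x ≠ 0 ∧ quad (red x) = 0 ∧ red (h.1 x) = red x := by
  let lift : (Fin 8 → ZMod 2) → Fin 8 → ℤ := fun v i => (v i).val
  have hlift : ∀ v, red (lift v) = v := fun v => by
    ext i; simp [red, lift]
  let f : Function.End Singular := fun v => ⟨red (h.1 (lift v)),
    red_apply_ne_zero (by rw [hlift]; exact v.2.1) h, by
      rw [quad_red, quad_apply, ← quad_red, hlift]; exact v.2.2⟩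
  have hf : ∀ (v : Singular) x, red x = v → (f v : Fin 8 → ZMod 2) = red (h.1 x) :=
    fun v x hx => red_apply_eq (by rw [hlift, hx]) h
  have hf4 : f ^ 2 ^ 2 = 1 := by
    funext v
    apply Subtype.ext
    have e1 := hf v _ (hlift v)
    have e2 := hf (f v) _ e1.symm
    have e3 := hf (f (f v)) _ e2.symm
    have e4 := hf (f (f (f v))) _ e3.symm
    have : (h ^ 4).1 (lift v) = lift v := by rw [h4]; rfl
    change (f (f (f (f v))) : Fin 8 → ZMod 2) = v
    rw [e4, ← hlift v]
    exact congrArg red (by rw [hlift]; exact this)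
  have hc := Equiv.Perm.card_fixedPoints_modEq (p := 2) hf4
  rw [card_singular] at hc
  have hne : Fintype.card (Function.fixedPoints f) ≠ 0 := by
    intro h0
    rw [h0] at hc
    exact absurd hc (by decide)
  obtain ⟨v, hv⟩ := Fintype.card_pos_iff.1 (Nat.pos_of_ne_zero hne)
  refine ⟨lift v, by rw [hlift]; exact v.2.1, by rw [hlift]; exact v.2.2, ?_⟩
  rw [hlift]
  exact congrArg Subtype.val hv

theorem eq_or_eq_neg_stdFrame {u : Fin 8 → ℤ} (hu : E8Form u u = 4)
    (hr : red u = red (stdFrame 0)) : ∃ j, u = stdFrame j ∨ u = -stdFrame j := by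
  obtain ⟨y, hy⟩ := red_eq_iff.1 hr
  have hc : ∀ i, coord u i = (if 0 = i then 4 else 0) + 2 * coord y i := fun i => by
    rw [hy, coord_add, coord_smul, coord_stdFrame]
  choose e he using two_dvd_coord_sub y
  set p := coord y 0 with hp
  have hsq := four_mul_E8Form u u
  rw [hu] at hsq
  -- The squares of the coordinates of `u` add up to 16. If `p` were odd, all eight coordinates
  -- would be even and nonzero, giving at least 32. So all are multiples of 4, and exactly one is
  -- `±4`.
  have hpar : (2 : ℤ) ∣ p := by
    by_contra hodd
    have hone : ∀ i, 4 ≤ coord u i * coord u i := by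
      intro i
      have h2 : ∃ m, coord u i = 2 * m ∧ m ≠ 0 := by
        refine ⟨(if 0 = i then 2 else 0) + coord y i, ?_, ?_⟩
        · rw [hc]; split_ifs <;> ring
        · have := he i
          split_ifs <;> omega
      obtain ⟨m, hm, hm0⟩ := h2
      have : 0 < m ^ 2 := by positivity
      rw [hm]
      nlinarith
    have : ∑ _i : Fin 8, (4 : ℤ) ≤ ∑ i, coord u i * coord u i :=
      Finset.sum_le_sum fun i _ => hone i
    simp at this
    omega
  have hfour : ∀ i, ∃ m, coord u i = 4 * m := fun i => by
    obtain ⟨q, hq⟩ := hpar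
    refine ⟨(if 0 = i then 1 else 0) + e i + q, ?_⟩
    have := he i
    rw [hc]
    split_ifs <;> omega
  choose m hm using hfour
  have hms : ∑ i, m i * m i = 1 := by
    have : ∑ i, coord u i * coord u i = 16 * ∑ i, m i * m i := by
      rw [Finset.mul_sum]
      exact Finset.sum_congr rfl fun i _ => by rw [hm]; ring
    omega
  obtain ⟨j, hj⟩ : ∃ j, m j ≠ 0 := by
    by_contra! h0
    simp [h0] at hms
  have hsplit := Finset.add_sum_erase Finset.univ (fun i => m i * m i) (Finset.mem_univ j)
  have hj1 : 1 ≤ m j * m j := by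
    have : 0 < m j * m j := mul_self_pos.2 hj
    omega
  have hrest : 0 ≤ ∑ i ∈ Finset.univ.erase j, m i * m i :=
    Finset.sum_nonneg fun i _ => mul_self_nonneg _
  have hj2 : m j * m j = 1 := by omega
  have hrest0 : ∑ i ∈ Finset.univ.erase j, m i * m i = 0 := by omega
  rw [Finset.sum_eq_zero_iff_of_nonneg fun i _ => mul_self_nonneg _] at hrest0
  have hzero : ∀ i, i ≠ j → m i = 0 := fun i hi =>
    mul_self_eq_zero.1 (hrest0 i (Finset.mem_erase.2 ⟨hi, Finset.mem_univ _⟩))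
  refine ⟨j, ?_⟩
  rcases mul_self_eq_one_iff.1 hj2 with h1 | h1
  · left
    apply coord_injective
    ext i
    rw [hm, coord_stdFrame]
    split_ifs with hij
    · rw [← hij, h1]; norm_num
    · rw [hzero i (Ne.symm hij), mul_zero]
  · right
    apply coord_injective
    ext i
    rw [hm, coord_neg, coord_stdFrame]
    split_ifs with hij
    · rw [← hij, h1]; norm_num
    · rw [hzero i (Ne.symm hij), mul_zero, neg_zero]

theorem red_stdFrame (i : Fin 8) : red (stdFrame i) = red (stdFrame 0) := by
  revert i; decide

/-- Every isometry `h` with `h ^ 4 = 1` is conjugate to one that acts on the standard frame by a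
signed permutation. -/
theorem exists_conj_monomial (h : OE8) (h4 : h ^ 4 = 1) :
    ∃ (g : OE8) (σ : Fin 8 → Fin 8) (s : Fin 8 → ℤ), (∀ i, s i = 1 ∨ s i = -1) ∧
      ∀ i, (g * h * g⁻¹).1 (stdFrame i) = s i • stdFrame (σ i) := by
  obtain ⟨x, hx0, hxq, hx⟩ := exists_red_fixed h h4
  obtain ⟨g, hg⟩ := exists_red_apply_eq x hx0 hxq
  have key : ∀ i, red ((g * h * g⁻¹).1 (stdFrame i)) = red (stdFrame 0) := by
    intro i
    rw [red_apply_eq ((red_stdFrame i).trans hg.symm), mul_apply', inv_apply_self, mul_apply',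
      red_apply_eq hx, hg]
  have : ∀ i, ∃ (j : Fin 8) (s : ℤ), (s = 1 ∨ s = -1) ∧
      (g * h * g⁻¹).1 (stdFrame i) = s • stdFrame j := by
    intro i
    obtain ⟨j, hj | hj⟩ := eq_or_eq_neg_stdFrame (u := (g * h * g⁻¹).1 (stdFrame i))
      (by rw [isometry_apply]; exact (coord_stdFrame i i).trans (if_pos rfl)) (key i)
    · exact ⟨j, 1, Or.inl rfl, by rw [hj, one_smul]⟩
    · exact ⟨j, -1, Or.inr rfl, by rw [hj, neg_one_smul]⟩
  choose σ s hs hσ using this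
  exact ⟨g, σ, s, hs, hσ⟩

/-! ### Rootless isometries -/

theorem IsRootless.form_ne_two {h : OE8} (hr : IsRootless h) (x : Fin 8 → ℤ) :
    E8Form (h.1 x - x) (h.1 x - x) ≠ 2 :=
  hr _ ⟨x, rfl⟩

theorem isRootless_of_forall {h : OE8}
    (hr : ∀ x, E8Form (h.1 x - x) (h.1 x - x) ≠ 2) : IsRootless h := by
  rintro _ ⟨x, rfl⟩
  exact hr x

theorem IsRootless.conj {h : OE8} (hr : IsRootless h) (g : OE8) : IsRootless (g * h * g⁻¹) := by
  apply isRootless_of_forall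
  intro x
  have := hr.form_ne_two ((g⁻¹).1 x)
  rwa [← isometry_apply g, map_sub, apply_inv_self] at this

/-! ### Isometries that permute the vectors of the standard frame up to sign -/

theorem exists_half_add (i j : Fin 8) {s : ℤ} (hs : s = 1 ∨ s = -1) :
    ∃ x, (2 : ℤ) • x = stdFrame i + s • stdFrame j := by
  obtain ⟨x, hx⟩ := exists_coord_eq
    (fun k => (if i = k then 2 else 0) + s * (if j = k then 2 else 0))
    (by intro k; rcases hs with rfl | rfl <;> split_ifs <;> omega)
    (by
      rw [Finset.sum_add_distrib, ← Finset.mul_sum]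
      simp only [Finset.sum_ite_eq, Finset.mem_univ, if_true]
      rcases hs with rfl | rfl <;> norm_num)
  refine ⟨x, coord_injective ?_⟩
  ext k
  rw [coord_smul, coord_add, coord_smul, coord_stdFrame, coord_stdFrame, hx]
  dsimp only
  split_ifs <;> ring

/-- `h` maps the `i`-th vector of the standard frame to `s i` times the `σ i`-th one. -/
structure IsMonomial (h : OE8) (σ : Fin 8 → Fin 8) (s : Fin 8 → ℤ) : Prop where
  sign : ∀ i, s i = 1 ∨ s i = -1
  apply_stdFrame : ∀ i, h.1 (stdFrame i) = s i • stdFrame (σ i)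

namespace IsMonomial

variable {h : OE8} {σ : Fin 8 → Fin 8} {s : Fin 8 → ℤ}

theorem sign_mul_self (hm : IsMonomial h σ s) (i : Fin 8) : s i * s i = 1 := by
  rcases hm.sign i with h1 | h1 <;> rw [h1] <;> norm_num

theorem coord_apply_eq (hm : IsMonomial h σ s) (x : Fin 8 → ℤ) (i : Fin 8) :
    coord (h.1 x) (σ i) = s i * coord x i := by
  have h1 : coord x i = s i * coord (h.1 x) (σ i) := by
    rw [coord, ← isometry_apply h, hm.apply_stdFrame, map_smul, smul_eq_mul, coord]
  rw [h1, ← mul_assoc, hm.sign_mul_self, one_mul]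

theorem apply_apply_stdFrame (hm : IsMonomial h σ s) (i : Fin 8) :
    h.1 (h.1 (stdFrame i)) = (s i * s (σ i)) • stdFrame (σ (σ i)) := by
  rw [hm.apply_stdFrame, map_smul, hm.apply_stdFrame, smul_smul]

/-- If `2(h - 1)x = s F_j - F_i` for two different vectors `F_i`, `F_j` of the frame, then
`(h - 1)x` is a root. -/
theorem _root_.RootlessE8.IsRootless.false_of_two_smul (hr : IsRootless h) {x : Fin 8 → ℤ}
    {i j : Fin 8} (hij : j ≠ i) {a : ℤ} (ha : a = 1 ∨ a = -1)
    (hx : (2 : ℤ) • (h.1 x - x) = a • stdFrame j - stdFrame i) : False := by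
  apply hr.form_ne_two x
  have h1 : E8Form ((2 : ℤ) • (h.1 x - x)) ((2 : ℤ) • (h.1 x - x)) = 8 := by
    have e : ∀ k l, E8Form (stdFrame k) (stdFrame l) = if k = l then 4 else 0 := coord_stdFrame
    rw [hx]
    simp only [map_sub, LinearMap.sub_apply, map_smul, LinearMap.smul_apply, e, if_true,
      if_neg hij, if_neg hij.symm]
    rcases ha with rfl | rfl <;> norm_num
  simp only [map_smul, LinearMap.smul_apply, smul_eq_mul] at h1
  omega

/-- If `h` fixes `F_i` and `σ` moves `j`, then `h - 1` maps `(F_i + F_j) / 2` to the root `(h F_j -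
F_j) / 2`. If `σ` moves nothing, `h` is diagonal and `h ^ 2 = 1`. -/
theorem ne_one_of_fixed (hm : IsMonomial h σ s) (hr : IsRootless h) (h2 : h ^ 2 ≠ 1) {i : Fin 8}
    (hi : σ i = i) : s i = -1 := by
  by_contra hs
  have hs1 : s i = 1 := (hm.sign i).resolve_right hs
  have hfix : ∀ j, σ j = j := by
    intro j
    by_contra hj
    obtain ⟨x, hx⟩ := exists_half_add i j (Or.inl rfl)
    refine hr.false_of_two_smul (x := x) hj (hm.sign j) ?_
    rw [smul_sub, ← map_smul, hx, map_add, map_smul, hm.apply_stdFrame, hm.apply_stdFrame, hi, hs1]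
    module
  apply h2
  apply isometry_ext
  intro j
  rw [pow_two, mul_apply', hm.apply_apply_stdFrame, hfix, hfix, hm.sign_mul_self, one_smul]
  rfl

/-- `h - 1` maps `(F_i + h F_i) / 2` to `(h² F_i - F_i) / 2`, a root unless `σ (σ i) = i`. -/
theorem involutive (hm : IsMonomial h σ s) (hr : IsRootless h) (i : Fin 8) : σ (σ i) = i := by
  by_contra hi
  obtain ⟨x, hx⟩ := exists_half_add i (σ i) (hm.sign i)
  refine hr.false_of_two_smul (x := x) (a := s i * s (σ i)) hi ?_ ?_
  · rcases hm.sign i with h2 | h2 <;> rcases hm.sign (σ i) with h3 | h3 <;> simp [h2, h3]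
  · rw [smul_sub, ← map_smul, hx, map_add, map_smul, hm.apply_stdFrame, hm.apply_stdFrame,
      smul_smul]
    module

theorem four_mul_form (hm : IsMonomial h σ s) (hσ : ∀ i, σ (σ i) = i) (x : Fin 8 → ℤ) :
    4 * E8Form (h.1 x - x) (h.1 x - x) =
      ∑ i, (s (σ i) * coord x (σ i) - coord x i) ^ 2 := by
  rw [four_mul_E8Form]
  refine Finset.sum_congr rfl fun i _ => ?_
  have := hm.coord_apply_eq x (σ i)
  rw [hσ] at this
  rw [coord_sub, this, sq]

variable (σ s) in
/-- The fixed points of `σ`. -/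
def fixedSet : Finset (Fin 8) := {i | σ i = i}

variable (σ s) in
/-- Representatives of the two-cycles with product of signs `c`. -/
def cycleSet (c : ℤ) : Finset (Fin 8) := {i | i < σ i ∧ s i * s (σ i) = c}

theorem card_eq (hm : IsMonomial h σ s) (hσ : ∀ i, σ (σ i) = i) :
    (fixedSet σ).card + 2 * (cycleSet σ s (-1)).card + 2 * (cycleSet σ s 1).card = 8 := by
  have h1 : (cycleSet σ s (-1)).card + (cycleSet σ s 1).card
      = ({i | i < σ i} : Finset (Fin 8)).card := by
    rw [← Finset.card_union_of_disjoint]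
    · congr 1
      ext i
      simp only [cycleSet, Finset.mem_union, Finset.mem_filter, Finset.mem_univ, true_and]
      rcases hm.sign i with h2 | h2 <;> rcases hm.sign (σ i) with h3 | h3 <;> simp [h2, h3]
    · rw [Finset.disjoint_left]
      intro i hi hi'
      simp only [cycleSet, Finset.mem_filter] at hi hi'
      omega
  have h2 : ({i | σ i < i} : Finset (Fin 8)).card = ({i | i < σ i} : Finset (Fin 8)).card := by
    refine Finset.card_nbij' σ σ ?_ ?_ ?_ ?_ <;> intro i hi <;> simp_all
  have h3 : (fixedSet σ).card + ({i | i < σ i} : Finset (Fin 8)).card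
      + ({i | σ i < i} : Finset (Fin 8)).card = 8 := by
    rw [fixedSet, ← Finset.card_union_of_disjoint, ← Finset.card_union_of_disjoint]
    · refine Eq.trans (congrArg Finset.card ?_) (Finset.card_fin 8)
      ext i
      simp only [Finset.mem_union, Finset.mem_filter, Finset.mem_univ, true_and, iff_true]
      omega
    · rw [Finset.disjoint_left]
      intro i hi hi'
      simp only [Finset.mem_union, Finset.mem_filter, Finset.mem_univ, true_and] at hi hi'
      omega
    · rw [Finset.disjoint_left]
      intro i hi hi'
      simp only [Finset.mem_filter, Finset.mem_univ, true_and] at hi hi'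
      omega
  omega

theorem cycleSet_nonempty (hm : IsMonomial h σ s) (hσ : ∀ i, σ (σ i) = i) (h2 : h ^ 2 ≠ 1) :
    (cycleSet σ s (-1)).Nonempty := by
  by_contra he
  rw [Finset.not_nonempty_iff_eq_empty] at he
  have hlt : ∀ i, i < σ i → s i * s (σ i) = 1 := by
    intro i hi
    have : i ∉ cycleSet σ s (-1) := by rw [he]; exact Finset.notMem_empty i
    simp only [cycleSet, Finset.mem_filter, Finset.mem_univ, true_and, hi] at this
    rcases hm.sign i with h2 | h2 <;> rcases hm.sign (σ i) with h3 | h3 <;> simp_all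
  apply h2
  apply isometry_ext
  intro i
  rw [pow_two, mul_apply', hm.apply_apply_stdFrame, hσ]
  have : s i * s (σ i) = 1 := by
    rcases lt_trichotomy i (σ i) with hi | hi | hi
    · exact hlt i hi
    · rw [← hi, hm.sign_mul_self]
    · have := hlt (σ i) (by rwa [hσ])
      rwa [hσ, mul_comm] at this
  rw [this, one_smul]
  rfl

/-- The sum of the cardinalities is the norm of a vector of the form `(h - 1)x`. -/
theorem exists_form_eq (hm : IsMonomial h σ s) (hr : IsRootless h) (h2 : h ^ 2 ≠ 1) :
    ∃ x, E8Form (h.1 x - x) (h.1 x - x)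
      = (fixedSet σ).card + (cycleSet σ s (-1)).card := by
  have hσ := hm.involutive hr
  obtain ⟨i₀, hi₀⟩ := hm.cycleSet_nonempty hσ h2
  simp only [cycleSet, Finset.mem_filter, Finset.mem_univ, true_and] at hi₀
  obtain ⟨hlt, hs₀⟩ := hi₀
  -- The signs are chosen so that `h` matches the larger entry of each two-cycle; only fixed points
  -- and the smaller entries of negative cycles then contribute to `(h - 1)x`. Flipping the sign at
  -- `i₀` shifts the coordinate sum by 2, so `t` or `t'` lies in `E₈`.
  let t : Fin 8 → ℤ := fun i => if i ≤ σ i then 1 else s (σ i)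
  let t' : Fin 8 → ℤ := Function.update t i₀ (-1)
  have ht : ∀ i, t i = 1 ∨ t i = -1 := fun i => by
    simp only [t]; split_ifs
    · exact Or.inl rfl
    · exact hm.sign _
  have ht' : ∀ i, t' i = 1 ∨ t' i = -1 := fun i => by
    simp only [t', Function.update_apply]; split_ifs
    · exact Or.inr rfl
    · exact ht i
  have hti₀ : t i₀ = 1 := if_pos hlt.le
  have htσ : t (σ i₀) = s i₀ := by
    simp only [t]
    rw [if_neg (by rw [hσ]; exact not_le.2 hlt), hσ]
  have hsum : (4 : ℤ) ∣ ∑ i, t i ∨ (4 : ℤ) ∣ ∑ i, t' i := by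
    have h3 : ∑ i, t' i = ∑ i, t i - 2 := by
      have e1 := Finset.add_sum_erase Finset.univ t (Finset.mem_univ i₀)
      have e2 := Finset.add_sum_erase Finset.univ t' (Finset.mem_univ i₀)
      have e3 : ∑ i ∈ Finset.univ.erase i₀, t' i = ∑ i ∈ Finset.univ.erase i₀, t i :=
        Finset.sum_congr rfl fun i hi => Function.update_of_ne (Finset.ne_of_mem_erase hi) _ _
      have e4 : t' i₀ = -1 := Function.update_self _ _ _
      omega
    have h4 : (2 : ℤ) ∣ ∑ i, t i := by
      have : ∑ i, t i = ∑ i, (t i - 1) + 8 := by simp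
      rw [this]
      refine dvd_add (Finset.dvd_sum fun i _ => ?_) (by norm_num)
      rcases ht i with h | h <;> rw [h] <;> norm_num
    omega
  have hD : ∑ i, (s (σ i) * t (σ i) - t i) ^ 2
      = 4 * ((fixedSet σ).card + (cycleSet σ s (-1)).card) := by
    rw [fixedSet, cycleSet, Finset.card_filter, Finset.card_filter]
    push_cast
    rw [← Finset.sum_add_distrib, Finset.mul_sum]
    refine Finset.sum_congr rfl fun i _ => ?_
    simp only [t, hσ]
    rcases lt_trichotomy i (σ i) with hi | hi | hi
    · rw [if_neg hi.not_ge, if_pos hi.le, if_neg hi.ne']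
      rcases hm.sign i with h2 | h2 <;> rcases hm.sign (σ i) with h3 | h3 <;> simp [h2, h3, hi]
    · rw [if_pos hi.ge, if_pos hi.le, if_pos hi.symm, if_neg (fun e => e.1.ne hi), ← hi,
        hm.ne_one_of_fixed hr h2 hi.symm]
      norm_num
    · rw [if_pos hi.le, if_neg hi.not_ge, if_neg hi.ne, if_neg (fun e => e.1.not_gt hi)]
      ring
  -- The flip only exchanges the contributions at `i₀` and `σ i₀`.
  have hD' : ∑ i, (s (σ i) * t' (σ i) - t' i) ^ 2 = ∑ i, (s (σ i) * t (σ i) - t i) ^ 2 := by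
    rw [← Equiv.sum_comp (Equiv.swap i₀ (σ i₀))]
    refine Finset.sum_congr rfl fun i _ => ?_
    have hne : σ i₀ ≠ i₀ := hlt.ne'
    have e4 : t' i₀ = -1 := Function.update_self _ _ _
    have e5 : ∀ i, i ≠ i₀ → t' i = t i := fun i hi => Function.update_of_ne hi _ _
    by_cases h5 : i = i₀
    · rw [h5, Equiv.swap_apply_left, hσ, e4, e5 _ hne, htσ, hti₀]
      rcases hm.sign i₀ with h2 | h2 <;> rcases hm.sign (σ i₀) with h3 | h3 <;> simp_all
    · by_cases h6 : i = σ i₀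
      · rw [h6, Equiv.swap_apply_right, hσ, e4, e5 _ hne, htσ, hti₀]
        rcases hm.sign i₀ with h2 | h2 <;> rcases hm.sign (σ i₀) with h3 | h3 <;> simp_all
      · rw [Equiv.swap_apply_of_ne_of_ne h5 h6, e5 _ h5,
          e5 _ (fun e => h6 (by rw [← e, hσ]))]
  have hpar : ∀ u : Fin 8 → ℤ, (∀ i, u i = 1 ∨ u i = -1) → ∀ i, (2 : ℤ) ∣ u i - u 0 := by
    intro u hu i
    rcases hu i with h | h <;> rcases hu 0 with h' | h' <;> rw [h, h'] <;> norm_num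
  rcases hsum with hsum | hsum
  · obtain ⟨x, hx⟩ := exists_coord_eq t (hpar t ht) hsum
    refine ⟨x, ?_⟩
    have := hm.four_mul_form hσ x
    rw [hx, hD] at this
    omega
  · obtain ⟨x, hx⟩ := exists_coord_eq t' (hpar t' ht') hsum
    refine ⟨x, ?_⟩
    have := hm.four_mul_form hσ x
    rw [hx, hD', hD] at this
    omega

/-- Arithmetic of `f + 2n + 2p = 8` with `n > 0` and `f + n` an even number other than 2. -/
theorem card_cases (hm : IsMonomial h σ s) (hr : IsRootless h) (h2 : h ^ 2 ≠ 1) :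
    (cycleSet σ s (-1)).card = 4 ∨
    ((cycleSet σ s (-1)).card = 2 ∧ (fixedSet σ).card = 4) ∨
    ((cycleSet σ s (-1)).card = 2 ∧ (fixedSet σ).card = 2 ∧ (cycleSet σ s 1).card = 1) := by
  have h1 := hm.card_eq (hm.involutive hr)
  have h3 := (hm.cycleSet_nonempty (hm.involutive hr) h2).card_pos
  obtain ⟨x, hx⟩ := hm.exists_form_eq hr h2
  have h4 := hr.form_ne_two x
  have h5 := E8Form_self (h.1 x - x)
  omega

end IsMonomial

/-! ### Adapted frames -/

theorem IsFrame.map {f : Fin 8 → Fin 8 → ℤ} (hf : IsFrame f) (g : OE8) :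
    IsFrame (fun i => g.1 (f i)) where
  form_eq i j := (isometry_apply g _ _).trans (hf.form_eq i j)
  congr i := by
    obtain ⟨y, hy⟩ := hf.congr i
    exact ⟨g.1 y, by rw [hy, map_add, map_smul]⟩
  sum := by
    obtain ⟨y, hy⟩ := hf.sum
    exact ⟨g.1 y, by rw [← map_sum, hy, map_smul]⟩

/-- Every injective choice of vectors of the standard frame and signs gives a frame, up to the
parity of the number of signs. -/
theorem isFrame_or_isFrame {p : Fin 8 → Fin 8} (hp : Function.Injective p) {e : Fin 8 → ℤ}
    (he : ∀ i, e i = 1 ∨ e i = -1) {f : Fin 8 → Fin 8 → ℤ}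
    (hf : ∀ i, f i = e i • stdFrame (p i)) :
    IsFrame f ∨ IsFrame ![f 1, -f 0, f 2, f 3, f 4, f 5, f 6, f 7] := by
  have horth : ∀ i j, E8Form (f i) (f j) = if i = j then 4 else 0 := by
    intro i j
    have e1 : E8Form (stdFrame (p i)) (stdFrame (p j)) = if p i = p j then 4 else 0 :=
      coord_stdFrame _ _
    rw [hf, hf, map_smul, map_smul, LinearMap.smul_apply, e1]
    by_cases hij : i = j
    · subst hij
      rcases he i with h | h <;> simp [h]
    · rw [if_neg hij, if_neg (hp.ne hij), smul_zero, smul_zero]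
  have hred : ∀ i, red (f i) = red (stdFrame 0) := by
    intro i
    rw [hf, red_smul, red_stdFrame]
    rcases he i with h | h <;> rw [h]
    · rw [Int.cast_one, one_smul]
    · rw [show ((-1 : ℤ) : ZMod 2) = 1 from rfl, one_smul]
  have hcongr : ∀ i, ∃ y, f i = f 0 + (2 : ℤ) • y := fun i =>
    red_eq_iff.1 ((hred i).trans (hred 0).symm)
  let q : Fin 8 ≃ Fin 8 := Equiv.ofBijective p (Finite.injective_iff_bijective.1 hp)
  have key : ∀ u : Fin 8 → ℤ, (∀ i, u i = 1 ∨ u i = -1) → (4 : ℤ) ∣ ∑ i, u i →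
      ∃ y, ∑ i, u i • stdFrame i = (4 : ℤ) • y := by
    intro u hu h4
    obtain ⟨y, hy⟩ := exists_coord_eq u
      (by intro i; rcases hu i with h | h <;> rcases hu 0 with h' | h' <;> rw [h, h'] <;> norm_num)
      h4
    exact ⟨y, by rw [← sum_coord_smul, hy]⟩
  have key' : ∀ u : Fin 8 → ℤ, (∀ i, u i = 1 ∨ u i = -1) → (4 : ℤ) ∣ ∑ i, u i →
      ∃ y, ∑ i, u i • stdFrame (p i) = (4 : ℤ) • y := by
    intro u hu h4
    obtain ⟨y, hy⟩ := key (fun i => u (q.symm i)) (fun i => hu _)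
      (by rw [Equiv.sum_comp q.symm u]; exact h4)
    refine ⟨y, ?_⟩
    rw [← hy, ← Equiv.sum_comp q (fun i => u (q.symm i) • stdFrame i)]
    exact Finset.sum_congr rfl fun i _ => by rw [q.symm_apply_apply]; rfl
  -- The sum of eight signs is even, and one flip changes it by 2 modulo 4.
  have hsum : (4 : ℤ) ∣ ∑ i, e i ∨ (4 : ℤ) ∣ ∑ i, Function.update e 0 (-e 0) i := by
    have : ∀ i, (2 : ℤ) ∣ e i - 1 := fun i => by rcases he i with h | h <;> rw [h] <;> norm_num
    have h0 := this 0; have h1 := this 1; have h2 := this 2; have h3 := this 3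
    have h4 := this 4; have h5 := this 5; have h6 := this 6; have h7 := this 7
    have h0' := he 0
    simp only [Fin.sum_univ_eight]
    simp
    omega
  rcases hsum with hsum | hsum
  · left
    refine ⟨horth, hcongr, ?_⟩
    obtain ⟨y, hy⟩ := key' e he hsum
    exact ⟨y, by simp only [hf, hy]⟩
  · right
    have hred' : ∀ i, red ((![f 1, -f 0, f 2, f 3, f 4, f 5, f 6, f 7] : Fin 8 → Fin 8 → ℤ) i)
        = red (stdFrame 0) := by
      intro i
      fin_cases i <;> try exact hred _
      change red (-f 0) = _
      rw [← hred 0, red_eq_iff]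
      exact ⟨-f 0, by module⟩
    refine ⟨?_, fun i => red_eq_iff.1 ((hred' i).trans (hred' 0).symm), ?_⟩
    · intro i j
      fin_cases i <;> fin_cases j <;> simp [horth]
    · obtain ⟨y, hy⟩ := key' (Function.update e 0 (-e 0)) (fun i => by
        rw [Function.update_apply]
        split_ifs
        · rcases he 0 with h | h <;> simp [h]
        · exact he i) hsum
      refine ⟨y, ?_⟩
      rw [← hy]
      simp only [Fin.sum_univ_eight]
      simp [hf]
      abel

/-- `h` permutes the members of some frame up to sign, in the prescribed way. -/
def HasPattern (π : Fin 8 → Fin 8) (ε : Fin 8 → ℤ) (h : OE8) : Prop :=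
  ∃ f, IsFrame f ∧ ∀ i, h.1 (f i) = ε i • f (π i)

/-- An isometry carrying one frame to the other, through `stdFrame`, intertwines `h` and `k`. -/
theorem HasPattern.isConj {π : Fin 8 → Fin 8} {ε : Fin 8 → ℤ} {h k : OE8}
    (hh : HasPattern π ε h) (hk : HasPattern π ε k) : IsConj h k := by
  obtain ⟨f, hf, hf'⟩ := hh
  obtain ⟨f₂, hf₂, hf₂'⟩ := hk
  obtain ⟨a, ha⟩ := hf.exists_isometry
  obtain ⟨b, hb⟩ := hf₂.exists_isometry
  rw [isConj_iff]
  refine ⟨b * a⁻¹, ?_⟩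
  have hba : ∀ i, (b * a⁻¹).1 (f i) = f₂ i := fun i => by
    rw [mul_apply', ← ha, inv_apply_self, hb]
  rw [mul_inv_eq_iff_eq_mul]
  apply mul_right_cancel (b := a)
  apply isometry_ext
  intro i
  rw [mul_apply', mul_apply', mul_apply' (k * _), mul_apply' k, ha, hf', map_smul, hba, hba, hf₂']

theorem HasPattern.of_conj {π : Fin 8 → Fin 8} {ε : Fin 8 → ℤ} {h : OE8} (g : OE8)
    (hh : HasPattern π ε (g * h * g⁻¹)) : HasPattern π ε h := by
  obtain ⟨f, hf, hf'⟩ := hh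
  refine ⟨_, hf.map g⁻¹, fun i => ?_⟩
  have := congrArg (g⁻¹).1 (hf' i)
  rwa [mul_apply', mul_apply', inv_apply_self, map_smul] at this

/-- Four blocks with `h ^ 2 = -1`. -/
abbrev PatternE8 : OE8 → Prop :=
  HasPattern ![1, 0, 3, 2, 5, 4, 7, 6] ![1, -1, 1, -1, 1, -1, 1, -1]

/-- Two blocks with `h ^ 2 = -1`, and `-1` on the complement. -/
abbrev PatternNeg : OE8 → Prop :=
  HasPattern ![1, 0, 3, 2, 4, 5, 6, 7] ![1, -1, 1, -1, -1, -1, -1, -1]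

/-- Two blocks with `h ^ 2 = -1`, and minus a reflection on the complement. -/
abbrev PatternNegReflection : OE8 → Prop :=
  HasPattern ![1, 0, 3, 2, 4, 5, 7, 6] ![1, -1, 1, -1, -1, -1, 1, 1]

theorem IsMonomial.hasPattern {h : OE8} {σ : Fin 8 → Fin 8} {s : Fin 8 → ℤ}
    (hm : IsMonomial h σ s) (hr : IsRootless h) (h2 : h ^ 2 ≠ 1) :
    PatternE8 h ∨ PatternNeg h ∨ PatternNegReflection h := by
  have hσ := hm.involutive hr
  have hA : ∀ c ∈ IsMonomial.fixedSet σ, σ c = c ∧ s c = -1 := fun c hc => by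
    have hc' : σ c = c := by simpa [IsMonomial.fixedSet] using hc
    exact ⟨hc', hm.ne_one_of_fixed hr h2 hc'⟩
  have hT : ∀ u, ∀ c ∈ IsMonomial.cycleSet σ s u, c < σ c ∧ s c * s (σ c) = u := fun u c hc => by
    simpa [IsMonomial.cycleSet] using hc
  -- the action on a two-cycle
  have hB : ∀ c, h.1 (s c • stdFrame (σ c)) = (s c * s (σ c)) • stdFrame c := fun c => by
    rw [map_smul, hm.apply_stdFrame, hσ, smul_smul]
  have key : ∀ (p : Fin 8 → Fin 8) (e : Fin 8 → ℤ), (List.ofFn p).Nodup →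
      (∀ i, e i = 1 ∨ e i = -1) → ∀ f : Fin 8 → Fin 8 → ℤ, (∀ i, f i = e i • stdFrame (p i)) →
      IsFrame f ∨ IsFrame ![f 1, -f 0, f 2, f 3, f 4, f 5, f 6, f 7] :=
    fun p e hp he f hf => isFrame_or_isFrame (List.nodup_ofFn.1 hp) he hf
  have hs := hm.sign
  have hsq := hm.sign_mul_self
  rcases hm.card_cases hr h2 with h4 | ⟨h4, h5⟩ | ⟨h4, h5, h6⟩
  · left
    obtain ⟨a, b, c, d, hab, hac, had, hbc, hbd, hcd, h7⟩ := Finset.card_eq_four.1 h4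
    obtain ⟨ha1, ha2⟩ := hT (-1) a (by simp [h7])
    obtain ⟨hb1, hb2⟩ := hT (-1) b (by simp [h7])
    obtain ⟨hc1, hc2⟩ := hT (-1) c (by simp [h7])
    obtain ⟨hd1, hd2⟩ := hT (-1) d (by simp [h7])
    rcases key ![a, σ a, b, σ b, c, σ c, d, σ d] ![1, s a, 1, s b, 1, s c, 1, s d]
      (by simp; grind) (by intro i; fin_cases i <;> simp [hs])
      ![stdFrame a, s a • stdFrame (σ a), stdFrame b, s b • stdFrame (σ b),
        stdFrame c, s c • stdFrame (σ c), stdFrame d, s d • stdFrame (σ d)]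
      (by intro i; fin_cases i <;> simp) with hf | hf
    · refine ⟨_, hf, fun i => ?_⟩
      fin_cases i <;> simp [hB, ha2, hb2, hc2, hd2, hm.apply_stdFrame, -zsmul_eq_mul]
    -- Replacing `(f 0, f 1)` by `(f 1, -f 0)` corrects the parity and keeps the pattern, because
    -- `h` sends `f 0` to `f 1` and `f 1` to `-f 0`.
    · refine ⟨_, hf, fun i => ?_⟩
      fin_cases i <;> simp [hB, ha2, hb2, hc2, hd2, hm.apply_stdFrame, -zsmul_eq_mul]
  · right; left
    obtain ⟨a, b, hab, h7⟩ := Finset.card_eq_two.1 h4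
    obtain ⟨ha1, ha2⟩ := hT (-1) a (by simp [h7])
    obtain ⟨hb1, hb2⟩ := hT (-1) b (by simp [h7])
    obtain ⟨c, d, k, l, hcd, hck, hcl, hdk, hdl, hkl, h8⟩ := Finset.card_eq_four.1 h5
    obtain ⟨hc1, hc2⟩ := hA c (by simp [h8])
    obtain ⟨hd1, hd2⟩ := hA d (by simp [h8])
    obtain ⟨hk1, hk2⟩ := hA k (by simp [h8])
    obtain ⟨hl1, hl2⟩ := hA l (by simp [h8])
    rcases key ![a, σ a, b, σ b, c, d, k, l] ![1, s a, 1, s b, 1, 1, 1, 1]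
      (by simp; grind) (by intro i; fin_cases i <;> simp [hs])
      ![stdFrame a, s a • stdFrame (σ a), stdFrame b, s b • stdFrame (σ b),
        stdFrame c, stdFrame d, stdFrame k, stdFrame l]
      (by intro i; fin_cases i <;> simp) with hf | hf
    · refine ⟨_, hf, fun i => ?_⟩
      fin_cases i <;> simp [hB, ha2, hb2, hc1, hd1, hk1, hl1, hc2, hd2, hk2, hl2,
        hm.apply_stdFrame, -zsmul_eq_mul]
    · refine ⟨_, hf, fun i => ?_⟩
      fin_cases i <;> simp [hB, ha2, hb2, hc1, hd1, hk1, hl1, hc2, hd2, hk2, hl2,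
        hm.apply_stdFrame, -zsmul_eq_mul]
  · right; right
    obtain ⟨a, b, hab, h7⟩ := Finset.card_eq_two.1 h4
    obtain ⟨ha1, ha2⟩ := hT (-1) a (by simp [h7])
    obtain ⟨hb1, hb2⟩ := hT (-1) b (by simp [h7])
    obtain ⟨c, d, hcd, h8⟩ := Finset.card_eq_two.1 h5
    obtain ⟨hc1, hc2⟩ := hA c (by simp [h8])
    obtain ⟨hd1, hd2⟩ := hA d (by simp [h8])
    obtain ⟨k, h9⟩ := Finset.card_eq_one.1 h6
    obtain ⟨hk1, hk2⟩ := hT 1 k (by simp [h9])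
    rcases key ![a, σ a, b, σ b, c, d, k, σ k] ![1, s a, 1, s b, 1, 1, 1, s k]
      (by simp; grind) (by intro i; fin_cases i <;> simp [hs])
      ![stdFrame a, s a • stdFrame (σ a), stdFrame b, s b • stdFrame (σ b),
        stdFrame c, stdFrame d, stdFrame k, s k • stdFrame (σ k)]
      (by intro i; fin_cases i <;> simp) with hf | hf
    · refine ⟨_, hf, fun i => ?_⟩
      fin_cases i <;> simp [hB, ha2, hb2, hc1, hd1, hc2, hd2, hk2,
        hm.apply_stdFrame, -zsmul_eq_mul]
    · refine ⟨_, hf, fun i => ?_⟩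
      fin_cases i <;> simp [hB, ha2, hb2, hc1, hd1, hc2, hd2, hk2,
        hm.apply_stdFrame, -zsmul_eq_mul]

/-- The classification of the rootless isometries of order four. -/
theorem IsRootless.hasPattern {h : OE8} (hr : IsRootless h) (ho : orderOf h = 4) :
    PatternE8 h ∨ PatternNeg h ∨ PatternNegReflection h := by
  have h4 : h ^ 4 = 1 := ho ▸ pow_orderOf_eq_one h
  have h2 : h ^ 2 ≠ 1 := fun e => by
    have := orderOf_le_of_pow_eq_one (by norm_num) e
    omega
  obtain ⟨g, σ, s, hs, hm⟩ := exists_conj_monomial h h4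
  have hm' : IsMonomial (g * h * g⁻¹) σ s := ⟨hs, hm⟩
  have h2' : (g * h * g⁻¹) ^ 2 ≠ 1 := fun e => by
    rw [conj_pow] at e
    exact h2 (conj_eq_one_iff.1 e)
  rcases hm'.hasPattern (hr.conj g) h2' with h | h | h
  · exact Or.inl (h.of_conj g)
  · exact Or.inr (Or.inl (h.of_conj g))
  · exact Or.inr (Or.inr (h.of_conj g))

/-! ### The lattice `J` -/

theorem mem_J {h : OE8} {x : Fin 8 → ℤ} : x ∈ J h ↔ h.1 (h.1 x) = -x := by
  rw [J, LinearMap.mem_ker, ← add_eq_zero_iff_eq_neg]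
  rfl

theorem IsFrame.eq_of_form_eq {f : Fin 8 → Fin 8 → ℤ} (hf : IsFrame f) {x y : Fin 8 → ℤ}
    (h : ∀ i, E8Form x (f i) = E8Form y (f i)) : x = y := by
  obtain ⟨g, hg⟩ := hf.exists_isometry
  rw [← apply_inv_self g x, ← apply_inv_self g y]
  congr 1
  apply coord_injective
  ext i
  have := h i
  rwa [← hg, ← isometry_apply g⁻¹, ← isometry_apply g⁻¹ y, inv_apply_self] at this

theorem PatternE8.apply_apply {h : OE8} (hh : PatternE8 h) (x : Fin 8 → ℤ) :
    h.1 (h.1 x) = -x := by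
  obtain ⟨f, hf, hf'⟩ := hh
  apply hf.eq_of_form_eq
  intro i
  have h1 : h.1 (h.1 (f i)) = -f i := by
    rw [hf', map_smul, hf', smul_smul]
    fin_cases i <;> simp
  have h2 := (isometry_apply h (h.1 x) (h.1 (f i))).trans (isometry_apply h x (f i))
  rw [h1, map_neg] at h2
  rw [map_neg, LinearMap.neg_apply]
  omega

theorem PatternNeg.eq_zero {h : OE8} (hh : PatternNeg h) {x : Fin 8 → ℤ} (hx : h.1 x = x) :
    x = 0 := by
  obtain ⟨f, hf, hf'⟩ := hh
  apply hf.eq_of_form_eq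
  have h1 : ∀ i, E8Form x (f i) = E8Form x (h.1 (f i)) := fun i => by
    conv_rhs => rw [← hx, isometry_apply]
  simp only [hf', map_smul, smul_eq_mul] at h1
  have h0 := h1 0; have h1' := h1 1; have h2 := h1 2; have h3 := h1 3
  have h4 := h1 4; have h5 := h1 5; have h6 := h1 6; have h7 := h1 7
  simp at h0 h1' h2 h3 h4 h5 h6 h7
  intro i
  rw [map_zero, LinearMap.zero_apply]
  fin_cases i <;> simp <;> omega

theorem PatternNegReflection.exists_fixed {h : OE8} (hh : PatternNegReflection h) :
    ∃ x ≠ 0, h.1 x = x := by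
  obtain ⟨f, hf, hf'⟩ := hh
  refine ⟨f 6 + f 7, fun h0 => ?_, ?_⟩
  · have h1 := hf.form_eq 6 6
    have h2 := hf.form_eq 6 7
    have h3 : E8Form (f 6) (f 6 + f 7) = 0 := by rw [h0, map_zero]
    rw [map_add, h1, h2] at h3
    simp at h3
  · rw [map_add, hf', hf']
    simp [add_comm]

/-- `J ≅ D₄` if `h ^ 2` is `-1` on one half of a frame and `1` on the other half. -/
theorem jIsD4_of_frame {h : OE8} {f : Fin 8 → Fin 8 → ℤ} (hf : IsFrame f)
    (h1 : ∀ i, h.1 (h.1 (f i)) = (if i < 4 then (-1 : ℤ) else 1) • f i) : JIsD4 h := by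
  obtain ⟨g, hg⟩ := hf.exists_isometry
  have hmem : ∀ x, g.1 x ∈ J h ↔ ∀ i, 4 ≤ i → coord x i = 0 := by
    intro x
    have hform : ∀ i, E8Form (g.1 x) (f i) = coord x i := fun i => by
      rw [← hg, isometry_apply]; rfl
    have h2 : ∀ i, E8Form (h.1 (h.1 (g.1 x))) (f i) = (if i < 4 then -1 else 1) * coord x i := by
      intro i
      have h3 := (isometry_apply h (h.1 (g.1 x)) (h.1 (f i))).trans
        (isometry_apply h (g.1 x) (f i))
      rw [h1, map_smul, smul_eq_mul, hform] at h3
      rw [← h3, ← mul_assoc]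
      split_ifs <;> ring
    rw [mem_J]
    constructor
    · intro h3 i hi
      have h4 := h2 i
      rw [h3, map_neg, LinearMap.neg_apply, hform, if_neg (not_lt.2 hi)] at h4
      omega
    · intro h3
      apply hf.eq_of_form_eq
      intro i
      rw [h2, map_neg, LinearMap.neg_apply, hform]
      split_ifs with hi
      · ring
      · rw [h3 i (not_lt.1 hi)]; ring
  have key : ∀ d : latticeD 4, ∃ x, coord x =
      ![2 * d.1 0, 2 * d.1 1, 2 * d.1 2, 2 * d.1 3, 0, 0, 0, 0] := by
    intro d
    apply exists_coord_eq
    · intro i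
      fin_cases i <;> simp <;> omega
    · obtain ⟨k, hk⟩ : Even (∑ i, d.1 i) := d.2
      rw [Fin.sum_univ_four] at hk
      rw [Fin.sum_univ_eight]
      simp
      omega
  choose z hz using key
  let Ψ : latticeD 4 →ₗ[ℤ] J h :=
    { toFun := fun d => ⟨g.1 (z d), (hmem _).2 fun i hi => by
        rw [hz]; fin_cases i <;> simp at hi ⊢⟩
      map_add' := fun d d' => by
        apply Subtype.ext
        change g.1 _ = g.1 _ + g.1 _
        rw [← map_add]
        congr 1
        apply coord_injective
        ext i
        rw [coord_add, hz, hz, hz]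
        fin_cases i <;> simp <;> ring
      map_smul' := fun n d => by
        apply Subtype.ext
        change g.1 _ = n • g.1 _
        rw [← map_smul]
        congr 1
        apply coord_injective
        ext i
        rw [coord_smul, hz, hz]
        fin_cases i <;> simp <;> ring }
  have hΨ : ∀ d, (Ψ d : Fin 8 → ℤ) = g.1 (z d) := fun _ => rfl
  have hbij : Function.Bijective Ψ := by
    constructor
    · intro d d' hd
      have h2 : coord (z d) = coord (z d') :=
        congrArg coord (g.1.injective (congrArg Subtype.val hd))
      rw [hz, hz] at h2
      apply Subtype.ext
      ext i
      have h3 := congrFun h2 (Fin.castLE (by norm_num) i)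
      fin_cases i <;> simpa using h3
    · intro y
      set x := (g⁻¹).1 y.1 with hx
      have hy : g.1 x = y.1 := apply_inv_self g _
      have hx4 := (hmem x).1 (hy ▸ y.2)
      have h4 := hx4 4 (by decide)
      -- All coordinates have the parity of the vanishing coordinate 4; halving them gives `D₄`,
      -- whose even-sum condition is divisibility of the full sum by 4.
      have hev : ∀ i, (2 : ℤ) ∣ coord x i := fun i => by
        have := two_dvd_coord_sub x i
        have := two_dvd_coord_sub x 4
        omega
      choose m hm using hev
      have hsum := four_dvd_sum_coord x
      rw [Fin.sum_univ_eight, h4, hx4 5 (by decide), hx4 6 (by decide), hx4 7 (by decide), hm 0,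
        hm 1, hm 2, hm 3] at hsum
      have hd : (![m 0, m 1, m 2, m 3] : Fin 4 → ℤ) ∈ latticeD 4 := by
        change Even (∑ i, _)
        rw [Fin.sum_univ_four, even_iff_two_dvd]
        simp
        omega
      refine ⟨⟨_, hd⟩, Subtype.ext ?_⟩
      rw [hΨ, ← hy]
      congr 1
      apply coord_injective
      rw [hz]
      ext i
      fin_cases i
      · exact (hm 0).symm
      · exact (hm 1).symm
      · exact (hm 2).symm
      · exact (hm 3).symm
      · exact h4.symm
      · exact (hx4 5 (by decide)).symm
      · exact (hx4 6 (by decide)).symm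
      · exact (hx4 7 (by decide)).symm
  have hiso : ∀ d d', E8Form (Ψ d) (Ψ d') = formD 4 d d' := by
    intro d d'
    rw [hΨ, hΨ, isometry_apply]
    have h2 := four_mul_E8Form (z d) (z d')
    rw [hz, hz, Fin.sum_univ_eight] at h2
    have h3 : formD 4 d d' = ∑ i, d.1 i * d'.1 i := by
      simp [formD, dotForm, Matrix.toBilin'_apply', dotProduct]
    rw [h3, Fin.sum_univ_four]
    simp at h2
    linarith
  let e := LinearEquiv.ofBijective Ψ hbij
  refine ⟨⟨e.symm, fun x y => ?_⟩⟩
  have h2 := hiso (e.symm x) (e.symm y)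
  have h3 : ∀ x, Ψ (e.symm x) = x := e.apply_symm_apply
  rw [h3, h3] at h2
  exact h2.symm

theorem PatternNeg.jIsD4 {h : OE8} (hh : PatternNeg h) : JIsD4 h := by
  obtain ⟨f, hf, hf'⟩ := hh
  refine jIsD4_of_frame hf fun i => ?_
  rw [hf', map_smul, hf', smul_smul]
  fin_cases i <;> simp

theorem PatternNegReflection.jIsD4 {h : OE8} (hh : PatternNegReflection h) : JIsD4 h := by
  obtain ⟨f, hf, hf'⟩ := hh
  refine jIsD4_of_frame hf fun i => ?_
  rw [hf', map_smul, hf', smul_smul]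
  fin_cases i <;> simp

/-- An isometric copy of `E₈` inside `E₈` is everything, by unimodularity. -/
theorem jIsE8_iff {h : OE8} : JIsE8 h ↔ ∀ x, h.1 (h.1 x) = -x := by
  constructor
  · rintro ⟨e⟩ x
    let T : (Fin 8 → ℤ) →ₗ[ℤ] (Fin 8 → ℤ) :=
      (J h).subtype ∘ₗ e.symm.toLinearEquiv.toLinearMap
    obtain ⟨g, hg⟩ := exists_isometry_eq T fun x y => e.symm.map_app y x
    rw [← apply_inv_self g x, hg]
    exact mem_J.1 (e.symm ((g⁻¹).1 x)).2
  · intro hx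
    have htop : ∀ x, x ∈ J h := fun x => mem_J.2 (hx x)
    exact ⟨⟨LinearEquiv.ofTop (J h) (Submodule.eq_top_iff'.2 htop), fun _ _ => rfl⟩⟩

/-- The ranks differ. -/
theorem not_jIsE8_of_jIsD4 {h : OE8} (h4 : JIsD4 h) : ¬ JIsE8 h := by
  rintro ⟨e⟩
  obtain ⟨e'⟩ := h4
  have h1 := LinearEquiv.finrank_eq e.toLinearEquiv
  have h2 := LinearEquiv.finrank_eq e'.toLinearEquiv
  have h3 := Submodule.finrank_le (latticeD 4)
  simp at h1 h3
  omega

/-! ### The isometries with square `-1` -/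

theorem form_sub_self (h : OE8) (x : Fin 8 → ℤ) :
    E8Form (h.1 x - x) (h.1 x - x) = 2 * E8Form x x - 2 * E8Form x (h.1 x) := by
  simp only [map_sub, LinearMap.sub_apply, isometry_apply, E8Form_comm (h.1 x) x]
  ring

/-- Here `(h - 1)x` has norm at least twice that of `x`, so norm 2 would need `x` of norm at most 1.
-/
theorem isRootless_of_form_nonpos {h : OE8} (hn : ∀ x, E8Form x (h.1 x) ≤ 0) :
    IsRootless h := by
  apply isRootless_of_forall
  intro x hx
  have h1 := form_sub_self h x
  have h2 := hn x
  have h3 : x = 0 := eq_zero_of_E8Form_self_lt_two (by omega)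
  subst h3
  simp at hx

theorem isRootless_of_apply_apply {h : OE8} (hh : ∀ x, h.1 (h.1 x) = -x) : IsRootless h := by
  apply isRootless_of_form_nonpos
  intro x
  have h1 := isometry_apply h x (h.1 x)
  rw [hh, map_neg, E8Form_comm (h.1 x) x] at h1
  omega

theorem orderOf_eq_four {h : OE8} (h4 : h ^ 4 = 1) (h2 : h ^ 2 ≠ 1) : orderOf h = 4 := by
  have := orderOf_eq_prime_pow (p := 2) (n := 1) (x := h) (by simpa using h2) (by simpa using h4)
  simpa using this

theorem orderOf_of_apply_apply {h : OE8} (hh : ∀ x, h.1 (h.1 x) = -x) : orderOf h = 4 := by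
  apply orderOf_eq_four
  · apply isometry_ext
    intro i
    change h.1 (h.1 (h.1 (h.1 _))) = _
    rw [hh, hh, neg_neg]
    rfl
  · intro h2
    have h3 : h.1 (h.1 (stdFrame 0)) = stdFrame 0 := by
      rw [← mul_apply', ← pow_two, h2]; rfl
    rw [hh] at h3
    exact absurd h3 (by decide)

theorem patternE8_of_apply_apply {h : OE8} (hh : ∀ x, h.1 (h.1 x) = -x) : PatternE8 h := by
  have hJ := jIsE8_iff.2 hh
  rcases (isRootless_of_apply_apply hh).hasPattern (orderOf_of_apply_apply hh) with h1 | h1 | h1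
  · exact h1
  · exact absurd hJ (not_jIsE8_of_jIsD4 h1.jIsD4)
  · exact absurd hJ (not_jIsE8_of_jIsD4 h1.jIsD4)

theorem exists_patternE8 : ∃ h : OE8, PatternE8 h := by
  -- `w` is a quarter of the sum of the frame below.
  obtain ⟨w, hw⟩ := exists_coord_eq ![-1, 1, -1, 1, -1, 1, -1, 1]
    (by decide) (by decide)
  have hf : IsFrame ![stdFrame 1, -stdFrame 0, stdFrame 3, -stdFrame 2, stdFrame 5, -stdFrame 4,
      stdFrame 7, -stdFrame 6] := by
    refine ⟨?_, ?_, ?_⟩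
    · intro i j
      rw [E8Form_apply]
      revert i j
      decide
    · intro i
      exact red_eq_iff.1 (by revert i; decide)
    · refine ⟨w, ?_⟩
      rw [← sum_coord_smul, hw]
      decide
  obtain ⟨h, hh⟩ := hf.exists_isometry
  have hstd : IsFrame stdFrame := by
    refine ⟨coord_stdFrame, fun i => red_eq_iff.1 (red_stdFrame i), ?_⟩
    exact ⟨![1, 3, 3, 5, 4, 3, 2, 1], by decide⟩
  refine ⟨h, stdFrame, hstd, fun i => ?_⟩
  rw [hh]
  fin_cases i <;> simp

/-! ### The lattice `Q` -/

theorem dotForm_apply (n : ℕ) (x y : Fin n → ℤ) : dotForm n x y = ∑ i, x i * y i := by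
  simp [dotForm, Matrix.toBilin'_apply', dotProduct]

theorem formA_apply (n : ℕ) (x y : latticeA n) : formA n x y = ∑ i, x.1 i * y.1 i :=
  dotForm_apply _ _ _

theorem formA₃_apply (x y : latticeA 3) : formA 3 x y =
    x.1 0 * y.1 0 + x.1 1 * y.1 1 + x.1 2 * y.1 2 + x.1 3 * y.1 3 := by
  rw [formA_apply]
  exact Fin.sum_univ_four _

theorem formA₁_apply (x y : latticeA 1) : formA 1 x y = x.1 0 * y.1 0 + x.1 1 * y.1 1 := by
  rw [formA_apply]
  exact Fin.sum_univ_two _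

theorem formQ_apply (x y : Q) : formQ x y = formA 3 x.1.1 y.1.1 + formA 3 x.1.2 y.1.2
    + (formA 1 x.2.1 y.2.1 + formA 1 x.2.2 y.2.2) := rfl

theorem sum_latticeA₃ (a : latticeA 3) : a.1 0 + a.1 1 + a.1 2 + a.1 3 = 0 := by
  have h : ∑ i, a.1 i = 0 := a.2
  rwa [Fin.sum_univ_four] at h

theorem sum_latticeA₁ (a : latticeA 1) : a.1 0 + a.1 1 = 0 := by
  have h : ∑ i, a.1 i = 0 := a.2
  rwa [Fin.sum_univ_two] at h

/-- The simple roots of `A₃`. -/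
def rootA₃ : Fin 3 → latticeA 3 :=
  ![⟨![1, -1, 0, 0], by change ∑ i, _ = _; decide⟩, ⟨![0, 1, -1, 0], by change ∑ i, _ = _; decide⟩,
    ⟨![0, 0, 1, -1], by change ∑ i, _ = _; decide⟩]

/-- The simple root of `A₁`. -/
def rootA₁ : latticeA 1 := ⟨![1, -1], by change ∑ i, _ = _; decide⟩

/-- The reflection in a vector of norm `2`. -/
def reflect {M : Type*} [AddCommGroup M] (B : BilinForm ℤ M) (r x : M) : M := x - B x r • r

/-- A 4-cycle is a product of three transpositions, which are reflections in roots; this is what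
makes `hA 3` extend to `E₈`. -/
theorem hA₃_eq (a : latticeA 3) : hA 3 a = reflect (formA 3) (rootA₃ 2)
    (reflect (formA 3) (rootA₃ 1) (reflect (formA 3) (rootA₃ 0) a)) := by
  apply Subtype.ext
  ext i
  simp only [reflect, formA₃_apply, hA, Submodule.coe_sub, Submodule.coe_smul, Pi.sub_apply,
    Pi.smul_apply, smul_eq_mul]
  fin_cases i <;> simp [rootA₃, LinearMap.restrict_apply, LinearMap.funLeft_apply]

theorem hA₁_eq (a : latticeA 1) : hA 1 a = reflect (formA 1) rootA₁ a := by
  apply Subtype.ext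
  ext i
  simp only [reflect, formA₁_apply, hA]
  fin_cases i <;> simp [rootA₁, LinearMap.restrict_apply, LinearMap.funLeft_apply, -zsmul_eq_mul]

theorem hA₃_sum (a : latticeA 3) : hA 3 (hA 3 (hA 3 a)) + hA 3 (hA 3 a) + hA 3 a + a = 0 := by
  have := sum_latticeA₃ a
  apply Subtype.ext
  ext i
  simp only [hA]
  fin_cases i <;> simp [LinearMap.restrict_apply, LinearMap.funLeft_apply] <;> linarith

theorem hA₁_hA₁ (a : latticeA 1) : hA 1 (hA 1 a) = a := by
  apply Subtype.ext
  ext i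
  simp only [hA]
  fin_cases i <;> simp [LinearMap.restrict_apply, LinearMap.funLeft_apply]

theorem hA₁_add (a : latticeA 1) : hA 1 a + a = 0 := by
  have := sum_latticeA₁ a
  apply Subtype.ext
  ext i
  simp only [hA]
  fin_cases i <;> simp [LinearMap.restrict_apply, LinearMap.funLeft_apply] <;> linarith

theorem hA₁_sum (a : latticeA 1) : hA 1 (hA 1 (hA 1 a)) + hA 1 (hA 1 a) + hA 1 a + a = 0 := by
  rw [add_assoc, hA₁_add, zero_add, hA₁_add]

theorem four_smul_eq (a : latticeA 1) : (4 : ℤ) • a = (2 : ℤ) • (formA 1 a rootA₁ • rootA₁) := by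
  have := sum_latticeA₁ a
  apply Subtype.ext
  ext i
  rw [formA₁_apply]
  fin_cases i <;> simp [rootA₁, -zsmul_eq_mul] <;> linarith

/-- The simple roots of `Q`. -/
def rootQ : Fin 8 → Q :=
  ![((rootA₃ 0, 0), (0, 0)), ((rootA₃ 1, 0), (0, 0)), ((rootA₃ 2, 0), (0, 0)),
    ((0, rootA₃ 0), (0, 0)), ((0, rootA₃ 1), (0, 0)), ((0, rootA₃ 2), (0, 0)),
    ((0, 0), (rootA₁, 0)), ((0, 0), (0, rootA₁))]

/-- The Gram matrix of the simple roots of `Q`. -/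
def gramQ : Matrix (Fin 8) (Fin 8) ℤ :=
  !![2, -1, 0, 0, 0, 0, 0, 0;
    -1, 2, -1, 0, 0, 0, 0, 0;
    0, -1, 2, 0, 0, 0, 0, 0;
    0, 0, 0, 2, -1, 0, 0, 0;
    0, 0, 0, -1, 2, -1, 0, 0;
    0, 0, 0, 0, -1, 2, 0, 0;
    0, 0, 0, 0, 0, 0, 2, 0;
    0, 0, 0, 0, 0, 0, 0, 2]

theorem det_gramQ : gramQ.det = 64 := by
  simp only [gramQ, norm_det]

theorem formQ_rootQ (i j : Fin 8) : formQ (rootQ i) (rootQ j) = gramQ i j := by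
  rw [formQ_apply]
  simp only [formA₃_apply, formA₁_apply]
  fin_cases i <;> fin_cases j <;> rfl

/-- An isometric embedding of `Q` in `E₈`. -/
theorem nonempty_embedding : Nonempty (formQ →bᵢ E8Form) := by
  let r : Fin 8 → Fin 8 → ℤ :=
    ![![0, 0, 0, -1, 0, 0, 0, 0], ![0, 0, -1, 0, 0, 0, 0, 0], ![0, 1, 1, 1, 0, 0, 0, 0],
      ![0, 0, 0, 0, 0, 0, -1, 0], ![0, 0, 0, 0, 0, -1, 0, 0], ![0, 1, 1, 2, 2, 2, 1, 0],
      ![-2, -2, -3, -4, -3, -2, -1, 0], ![2, 3, 4, 6, 5, 4, 3, 2]]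
  let T : Q →ₗ[ℤ] (Fin 8 → ℤ) :=
    -- Coefficients in simple roots are partial coordinate sums; the third one in `A₃` equals minus
    -- the last coordinate.
    { toFun := fun x => x.1.1.1 0 • r 0 + (x.1.1.1 0 + x.1.1.1 1) • r 1 - x.1.1.1 3 • r 2
        + x.1.2.1 0 • r 3 + (x.1.2.1 0 + x.1.2.1 1) • r 4 - x.1.2.1 3 • r 5
        + x.2.1.1 0 • r 6 + x.2.2.1 0 • r 7
      map_add' := fun x y => by
        simp only [Prod.fst_add, Prod.snd_add, Submodule.coe_add, Pi.add_apply]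
        module
      map_smul' := fun n x => by
        simp only [Prod.smul_fst, Prod.smul_snd, Submodule.coe_smul, Pi.smul_apply, smul_eq_mul,
          RingHom.id_apply]
        module }
  refine ⟨⟨T, ?_⟩⟩
  rintro ⟨⟨a, b⟩, c, d⟩ ⟨⟨a', b'⟩, c', d'⟩
  have ha := sum_latticeA₃ a
  have hb := sum_latticeA₃ b
  have hc := sum_latticeA₁ c
  have hd := sum_latticeA₁ d
  have ha' := sum_latticeA₃ a'
  have hb' := sum_latticeA₃ b'
  have hc' := sum_latticeA₁ c'
  have hd' := sum_latticeA₁ d'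
  have hr : ∀ i j, E8Form (r i) (r j) = gramQ i j := by
    intro i j
    rw [E8Form_apply]
    fin_cases i <;> fin_cases j <;> rfl
  change E8Form (_ • r 0 + _ • r 1 - _ • r 2 + _ • r 3 + _ • r 4 - _ • r 5 + _ • r 6 + _ • r 7)
    (_ • r 0 + _ • r 1 - _ • r 2 + _ • r 3 + _ • r 4 - _ • r 5 + _ • r 6 + _ • r 7) = _
  simp only [map_add, map_sub, map_smul, LinearMap.add_apply, LinearMap.sub_apply,
    LinearMap.smul_apply, hr, formQ_apply, formA₃_apply, formA₁_apply]
  simp only [gramQ, Matrix.of_apply]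
  simp [-zsmul_eq_mul]
  have e1 : a.1 2 = -(a.1 0 + a.1 1 + a.1 3) := by linarith
  have e2 : b.1 2 = -(b.1 0 + b.1 1 + b.1 3) := by linarith
  have e3 : c.1 1 = -c.1 0 := by linarith
  have e4 : d.1 1 = -d.1 0 := by linarith
  have e1' : a'.1 2 = -(a'.1 0 + a'.1 1 + a'.1 3) := by linarith
  have e2' : b'.1 2 = -(b'.1 0 + b'.1 1 + b'.1 3) := by linarith
  have e3' : c'.1 1 = -c'.1 0 := by linarith
  have e4' : d'.1 1 = -d'.1 0 := by linarith
  rw [e1, e2, e3, e4, e1', e2', e3', e4']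
  ring

/-- The span of the image of `Q` has finite index in `E₈`. -/
theorem exists_smul_mem (φ : formQ →bᵢ E8Form) :
    ∃ n : ℤ, n ≠ 0 ∧ ∀ y, ∃ x, n • y = φ x := by
  let M : Matrix (Fin 8) (Fin 8) ℤ := Matrix.of fun i j => φ (rootQ j) i
  have hM : ∀ v, M.mulVec v = φ (∑ j, v j • rootQ j) := by
    intro v
    rw [map_sum]
    ext i
    simp [M, Matrix.mulVec, dotProduct, mul_comm]
  have hgram : M.transpose * CartanMatrix.E₈ * M = gramQ := by
    have h1 := LinearMap.BilinForm.toMatrix'_comp E8Form M.toLin' M.toLin'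
    rw [LinearMap.toMatrix'_toLin', E8Form, LinearMap.BilinForm.toMatrix'_toBilin'] at h1
    rw [← h1]
    ext i j
    rw [LinearMap.BilinForm.toMatrix'_apply, LinearMap.BilinForm.comp_apply]
    change E8Form _ _ = _
    rw [Matrix.toLin'_apply, Matrix.toLin'_apply, hM, hM, φ.map_app, ← formQ_rootQ]
    simp [Pi.single_apply]
  -- The Gram determinant of `Q` is 64, so the embedded simple roots are independent and the
  -- adjugate inverts `M` up to `M.det`.
  have hdet : M.det ≠ 0 := by
    intro h0
    have h1 := congrArg Matrix.det hgram
    rw [Matrix.det_mul, h0, mul_zero, det_gramQ] at h1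
    norm_num at h1
  refine ⟨M.det, hdet, fun y => ⟨∑ j, M.adjugate.mulVec y j • rootQ j, ?_⟩⟩
  rw [← hM, Matrix.mulVec_mulVec, Matrix.mul_adjugate, Matrix.smul_mulVec, Matrix.one_mulVec]

theorem eq_of_comp_eq (φ : formQ →bᵢ E8Form) {S T : (Fin 8 → ℤ) →ₗ[ℤ] (Fin 8 → ℤ)}
    (h : ∀ x, S (φ x) = T (φ x)) (y : Fin 8 → ℤ) : S y = T y := by
  obtain ⟨n, hn, hy⟩ := exists_smul_mem φ
  obtain ⟨x, hx⟩ := hy y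
  apply smul_right_injective _ hn
  simp only [← map_smul, hx, h]

/-! ### Extension of isometries of `Q` to `E₈` -/

/-- The map `k` on the image of `Q` is induced by an isometry of `E₈`. -/
def Extendable (φ : formQ →bᵢ E8Form) (k : Q → Q) : Prop :=
  ∃ g : OE8, ∀ x, g.1 (φ x) = φ (k x)

theorem Extendable.comp {φ : formQ →bᵢ E8Form} {k l : Q → Q} (hk : Extendable φ k)
    (hl : Extendable φ l) : Extendable φ (k ∘ l) := by
  obtain ⟨g, hg⟩ := hk
  obtain ⟨g', hg'⟩ := hl
  exact ⟨g * g', fun x => by rw [mul_apply', hg', hg]; rfl⟩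

theorem extendable_reflect (φ : formQ →bᵢ E8Form) (i : Fin 8) :
    Extendable φ (reflect formQ (rootQ i)) := by
  have hr : E8Form (φ (rootQ i)) (φ (rootQ i)) = 2 := by
    rw [φ.map_app, formQ_rootQ]
    fin_cases i <;> rfl
  obtain ⟨g, hg⟩ := exists_reflection _ hr
  exact ⟨g, fun x => by rw [hg, φ.map_app, reflect, map_sub, map_smul]⟩

theorem reflect_fst_fst (v : latticeA 3) (x : Q) :
    reflect formQ ((v, 0), (0, 0)) x = ((reflect (formA 3) v x.1.1, x.1.2), x.2) := by
  obtain ⟨⟨a, b⟩, c, d⟩ := x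
  simp [reflect, formQ_apply]

theorem reflect_fst_snd (v : latticeA 3) (x : Q) :
    reflect formQ ((0, v), (0, 0)) x = ((x.1.1, reflect (formA 3) v x.1.2), x.2) := by
  obtain ⟨⟨a, b⟩, c, d⟩ := x
  simp [reflect, formQ_apply]

theorem reflect_snd_fst (v : latticeA 1) (x : Q) :
    reflect formQ ((0, 0), (v, 0)) x = (x.1, (reflect (formA 1) v x.2.1, x.2.2)) := by
  obtain ⟨⟨a, b⟩, c, d⟩ := x
  simp [reflect, formQ_apply]

theorem reflect_snd_snd (v : latticeA 1) (x : Q) :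
    reflect formQ ((0, 0), (0, v)) x = (x.1, (x.2.1, reflect (formA 1) v x.2.2)) := by
  obtain ⟨⟨a, b⟩, c, d⟩ := x
  simp [reflect, formQ_apply]

theorem exists_extends_hQ₂ (φ : formQ →bᵢ E8Form) : ∃ g : OE8, Extends φ hQ₂ g := by
  have h := (((((((extendable_reflect φ 2).comp (extendable_reflect φ 1)).comp
    (extendable_reflect φ 0)).comp (extendable_reflect φ 5)).comp
    (extendable_reflect φ 4)).comp (extendable_reflect φ 3)).comp (extendable_reflect φ 6))
  obtain ⟨g, hg⟩ := h
  refine ⟨g, fun x => ?_⟩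
  rw [hg]
  congr 1
  simp only [Function.comp_apply]
  change reflect formQ ((rootA₃ 2, 0), (0, 0)) (reflect formQ ((rootA₃ 1, 0), (0, 0))
    (reflect formQ ((rootA₃ 0, 0), (0, 0)) (reflect formQ ((0, rootA₃ 2), (0, 0))
    (reflect formQ ((0, rootA₃ 1), (0, 0)) (reflect formQ ((0, rootA₃ 0), (0, 0))
    (reflect formQ ((0, 0), (rootA₁, 0)) x)))))) = ((hA 3 x.1.1, hA 3 x.1.2), (hA 1 x.2.1, x.2.2))
  simp only [reflect_fst_fst, reflect_fst_snd, reflect_snd_fst, hA₃_eq, hA₁_eq]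

theorem exists_extends_hQ₁ (φ : formQ →bᵢ E8Form) : ∃ g : OE8, Extends φ hQ₁ g := by
  obtain ⟨g, hg⟩ := exists_extends_hQ₂ φ
  obtain ⟨g', hg'⟩ := extendable_reflect φ 7
  refine ⟨g' * g, fun x => ?_⟩
  rw [mul_apply', hg, hg']
  congr 1
  change reflect formQ ((0, 0), (0, rootA₁)) ((hA 3 x.1.1, hA 3 x.1.2), (hA 1 x.2.1, x.2.2)) =
    ((hA 3 x.1.1, hA 3 x.1.2), (hA 1 x.2.1, hA 1 x.2.2))
  rw [reflect_snd_snd, hA₁_eq x.2.2]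

/-! ### The extensions are rootless of order four -/

/-- `h` negates `w = x + h² x`, and `4 (x, hx) = (w, hw) = -(w, w)`. -/
theorem form_apply_nonpos {h : OE8} (h4 : h ^ 4 = 1) {x : Fin 8 → ℤ}
    (hx : h.1 (h.1 (h.1 x)) + h.1 (h.1 x) + h.1 x + x = 0) : E8Form x (h.1 x) ≤ 0 := by
  have hx4 : h.1 (h.1 (h.1 (h.1 x))) = x := by
    change (h ^ 4).1 x = x
    rw [h4]; rfl
  have h1 := E8Form_self_nonneg (x + h.1 (h.1 x))
  have h2 : h.1 (x + h.1 (h.1 x)) = -(x + h.1 (h.1 x)) := by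
    rw [map_add, eq_neg_iff_add_eq_zero, ← hx]
    abel
  have h3 : E8Form (x + h.1 (h.1 x)) (h.1 (x + h.1 (h.1 x))) = 4 * E8Form x (h.1 x) := by
    have e1 := isometry_apply h x (h.1 (h.1 (h.1 x)))
    have e2 := isometry_apply h (h.1 x) (h.1 (h.1 x))
    have e3 := isometry_apply h x (h.1 x)
    have e4 := E8Form_comm (h.1 x) x
    have e5 := E8Form_comm (h.1 (h.1 x)) (h.1 x)
    rw [hx4] at e1
    simp only [map_add, LinearMap.add_apply]
    omega
  rw [h2, map_neg] at h3
  omega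

section

variable {φ : formQ →bᵢ E8Form} {h : OE8}

theorem pow_two_ne_one_of_extends {k : Q →ₗ[ℤ] Q} (hk : Extends φ k h)
    (hne : formQ (k (k (rootQ 0)) - rootQ 0) (k (k (rootQ 0)) - rootQ 0) ≠ 0) : h ^ 2 ≠ 1 := by
  intro h2
  have h3 : h.1 (h.1 (φ (rootQ 0))) = φ (rootQ 0) := by
    rw [← mul_apply', ← pow_two, h2]; rfl
  apply hne
  rw [← φ.map_app, map_sub, ← hk, ← hk, h3, sub_self, map_zero]

theorem not_patternE8_of_extends {k : Q →ₗ[ℤ] Q} (hk : Extends φ k h)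
    (h6 : k (k (rootQ 6)) = rootQ 6) : ¬ PatternE8 h := by
  intro hp
  have h1 := hp.apply_apply (φ (rootQ 6))
  rw [hk, hk, h6, eq_neg_iff_add_eq_zero] at h1
  have h2 : E8Form (φ (rootQ 6)) (φ (rootQ 6) + φ (rootQ 6)) = 0 := by rw [h1, map_zero]
  rw [map_add, φ.map_app, formQ_rootQ] at h2
  exact absurd h2 (by decide)

theorem sum_of_extends_hQ₁ (hk : Extends φ hQ₁ h) (y : Fin 8 → ℤ) :
    h.1 (h.1 (h.1 y)) + h.1 (h.1 y) + h.1 y + y = 0 := by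
  let g := h.1.toLinearMap
  refine eq_of_comp_eq φ (S := g ∘ₗ g ∘ₗ g + g ∘ₗ g + g + LinearMap.id) (T := 0) (fun x => ?_) y
  change h.1 (h.1 (h.1 (φ x))) + h.1 (h.1 (φ x)) + h.1 (φ x) + φ x = 0
  rw [hk, hk, hk, ← map_add, ← map_add, ← map_add]
  refine (congrArg φ ?_).trans (map_zero φ)
  exact Prod.ext (Prod.ext (hA₃_sum _) (hA₃_sum _)) (Prod.ext (hA₁_sum _) (hA₁_sum _))

theorem hA₃_pow_four (a : latticeA 3) : hA 3 (hA 3 (hA 3 (hA 3 a))) = a := by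
  have h1 := hA₃_sum a
  have h2 := hA₃_sum (hA 3 a)
  rw [← sub_eq_zero, ← sub_self (0 : latticeA 3)]
  nth_rewrite 1 [← h2]
  rw [← h1]
  abel

theorem pow_four_of_extends {k : Q →ₗ[ℤ] Q} (hk : Extends φ k h)
    (hk4 : ∀ x, k (k (k (k x))) = x) : h ^ 4 = 1 := by
  apply isometry_ext
  intro i
  let g := h.1.toLinearMap
  refine eq_of_comp_eq φ (S := g ∘ₗ g ∘ₗ g ∘ₗ g) (T := LinearMap.id) (fun x => ?_) _
  change h.1 (h.1 (h.1 (h.1 (φ x)))) = φ x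
  rw [hk, hk, hk, hk, hk4]

theorem hQ₁_pow_four (x : Q) : hQ₁ (hQ₁ (hQ₁ (hQ₁ x))) = x := by
  refine Prod.ext (Prod.ext (hA₃_pow_four _) (hA₃_pow_four _)) (Prod.ext ?_ ?_)
  · exact (hA₁_hA₁ _).trans (hA₁_hA₁ _)
  · exact (hA₁_hA₁ _).trans (hA₁_hA₁ _)

theorem hQ₂_pow_four (x : Q) : hQ₂ (hQ₂ (hQ₂ (hQ₂ x))) = x := by
  refine Prod.ext (Prod.ext (hA₃_pow_four _) (hA₃_pow_four _)) (Prod.ext ?_ rfl)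
  exact (hA₁_hA₁ _).trans (hA₁_hA₁ _)

/-- The classification is applied to the extension itself. `h ^ 2` fixes a root, excluding
`PatternE8`; `1 + h + h² + h³ = 0` excludes nonzero fixed vectors. -/
theorem patternNeg_of_extends (hk : Extends φ hQ₁ h) : PatternNeg h := by
  have h4 := pow_four_of_extends hk hQ₁_pow_four
  have hsum := sum_of_extends_hQ₁ hk
  have h2 : h ^ 2 ≠ 1 := pow_two_ne_one_of_extends hk (by decide)
  have hr : IsRootless h := isRootless_of_form_nonpos fun x => form_apply_nonpos h4 (hsum x)
  rcases hr.hasPattern (orderOf_eq_four h4 h2) with hp | hp | hp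
  · exact absurd hp (not_patternE8_of_extends hk
      (Prod.ext rfl (Prod.ext (hA₁_hA₁ _) (hA₁_hA₁ _))))
  · exact hp
  · obtain ⟨x, hx0, hx⟩ := hp.exists_fixed
    have h5 := hsum x
    rw [hx, hx, hx] at h5
    refine absurd (smul_right_injective _ (by norm_num : (4 : ℤ) ≠ 0) ?_) hx0
    change (4 : ℤ) • x = (4 : ℤ) • 0
    rw [smul_zero, ← h5]
    module

/-- `1 + h + h² + h³` vanishes on the first three summands of `Q` and is multiplication by 4 on the
last `A₁`, that is, `2 (·, r) r` for its root `r`. -/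
theorem sum_of_extends_hQ₂ (hk : Extends φ hQ₂ h) (y : Fin 8 → ℤ) :
    h.1 (h.1 (h.1 y)) + h.1 (h.1 y) + h.1 y + y
      = (2 : ℤ) • E8Form y (φ (rootQ 7)) • φ (rootQ 7) := by
  let g := h.1.toLinearMap
  refine eq_of_comp_eq φ (S := g ∘ₗ g ∘ₗ g + g ∘ₗ g + g + LinearMap.id)
    (T := (2 : ℤ) • (E8Form.flip (φ (rootQ 7))).smulRight (φ (rootQ 7))) (fun x => ?_) y
  change h.1 (h.1 (h.1 (φ x))) + h.1 (h.1 (φ x)) + h.1 (φ x) + φ x =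
    (2 : ℤ) • E8Form (φ x) (φ (rootQ 7)) • φ (rootQ 7)
  rw [hk, hk, hk, ← map_add, ← map_add, ← map_add, φ.map_app, ← map_smul, ← map_smul]
  refine congrArg φ ?_
  have h7 : formQ x (rootQ 7) = formA 1 x.2.2 rootA₁ := by
    change formQ x ((0, 0), (0, rootA₁)) = _
    simp [formQ_apply]
  rw [h7]
  refine Prod.ext (Prod.ext ((hA₃_sum _).trans ?_) ((hA₃_sum _).trans ?_))
    (Prod.ext ((hA₁_sum _).trans ?_) ?_)
  · change 0 = (2 : ℤ) • formA 1 x.2.2 rootA₁ • (0 : latticeA 3)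
    rw [smul_zero, smul_zero]
  · change 0 = (2 : ℤ) • formA 1 x.2.2 rootA₁ • (0 : latticeA 3)
    rw [smul_zero, smul_zero]
  · change 0 = (2 : ℤ) • formA 1 x.2.2 rootA₁ • (0 : latticeA 1)
    rw [smul_zero, smul_zero]
  · change x.2.2 + x.2.2 + x.2.2 + x.2.2 = (2 : ℤ) • formA 1 x.2.2 rootA₁ • rootA₁
    have := four_smul_eq x.2.2
    rw [← this]
    module

theorem fixed_of_extends_hQ₂ (hk : Extends φ hQ₂ h) : h.1 (φ (rootQ 7)) = φ (rootQ 7) := by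
  rw [hk]
  refine congrArg φ (Prod.ext (Prod.ext (map_zero (hA 3)) (map_zero (hA 3)))
    (Prod.ext (map_zero (hA 1)) rfl))

theorem isRootless_of_extends_hQ₂ (hk : Extends φ hQ₂ h) : IsRootless h := by
  apply isRootless_of_forall
  intro y hy
  have h4 := pow_four_of_extends hk hQ₂_pow_four
  have hfix := fixed_of_extends_hQ₂ hk
  have hsum := sum_of_extends_hQ₂ hk
  set r := φ (rootQ 7) with hr
  have hrr : E8Form r r = 2 := by rw [hr, φ.map_app, formQ_rootQ]; rfl
  -- Subtracting multiples of the fixed root `r` does not change `(h - 1)y`, so `(x, r)` may be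
  -- taken to be 0 or 1.
  obtain ⟨m, b, hb, hm⟩ : ∃ m b : ℤ, (b = 0 ∨ b = 1) ∧ E8Form y r = 2 * m + b :=
    ⟨E8Form y r / 2, E8Form y r % 2, by omega, by omega⟩
  set x := y - m • r with hx
  have hxb : E8Form x r = b := by
    rw [hx, map_sub, map_smul, LinearMap.sub_apply, LinearMap.smul_apply, hrr, hm, smul_eq_mul]
    ring
  have hxy : h.1 x - x = h.1 y - y := by
    rw [hx, map_sub, map_smul, hfix]
    abel
  rw [← hxy] at hy
  -- Twice the projection of `x` to the complement of `r`, where `(z, hz) ≤ 0`. If `(h - 1)x` has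
  -- norm 2, then `8 ≥ 2 (z, z) = 8 (x, x) - 4 b²`, which forces `(x, x) < 2`.
  set z := (2 : ℤ) • x - b • r with hz
  have hzr : E8Form z r = 0 := by
    rw [hz, map_sub, map_smul, map_smul, LinearMap.sub_apply, LinearMap.smul_apply,
      LinearMap.smul_apply, hxb, hrr, smul_eq_mul, smul_eq_mul]
    ring
  have hzz : E8Form z z = 4 * E8Form x x - 2 * b ^ 2 := by
    rw [hz]
    simp only [map_sub, map_smul, LinearMap.sub_apply, LinearMap.smul_apply, hxb, hrr,
      smul_eq_mul, E8Form_comm r x]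
    ring
  have hzx : h.1 z - z = (2 : ℤ) • (h.1 x - x) := by
    rw [hz, map_sub, map_smul, map_smul, hfix]
    module
  have h5 := form_sub_self h z
  have h6 : E8Form z (h.1 z) ≤ 0 := form_apply_nonpos h4 (by
    rw [hsum, hzr, zero_smul, smul_zero])
  rw [hzx] at h5
  simp only [map_smul, LinearMap.smul_apply, smul_eq_mul, hy] at h5
  have hx0 : x = 0 := by
    apply eq_zero_of_E8Form_self_lt_two
    rcases hb with rfl | rfl <;> omega
  rw [hx0] at hy
  simp at hy

theorem patternNegReflection_of_extends (hk : Extends φ hQ₂ h) : PatternNegReflection h := by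
  have h4 := pow_four_of_extends hk hQ₂_pow_four
  have h2 : h ^ 2 ≠ 1 := pow_two_ne_one_of_extends hk (by decide)
  rcases (isRootless_of_extends_hQ₂ hk).hasPattern (orderOf_eq_four h4 h2) with hp | hp | hp
  · exact absurd hp (not_patternE8_of_extends hk (Prod.ext rfl (Prod.ext (hA₁_hA₁ _) rfl)))
  · have h5 := hp.eq_zero (fixed_of_extends_hQ₂ hk)
    have h6 : E8Form (φ (rootQ 7)) (φ (rootQ 7)) = 2 := by rw [φ.map_app, formQ_rootQ]; rfl
    rw [h5] at h6
    simp at h6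
  · exact hp

end

end RootlessE8

/-! ### The main theorem. -/

open RootlessE8 in
theorem theorem4p16 :
    Nonempty (formQ →bᵢ E8Form) ∧
    (∀ h : OE8, IsRootless h → orderOf h = 4 →
      (JIsD4 h ∨ JIsE8 h) ∧
      (JIsD4 h → ∀ φ : formQ →bᵢ E8Form, ∃ h₁ h₂ : OE8,
        Extends φ hQ₁ h₁ ∧ Extends φ hQ₂ h₂ ∧ (IsConj h h₁ ∨ IsConj h h₂)) ∧
      (JIsE8 h →
        (∀ x, h.1 x = x → x = 0) ∧ (∀ x, h.1 (h.1 x) = -x))) ∧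
    (∃ c : ConjClasses OE8,
      c.carrier = {h : OE8 | IsRootless h ∧ orderOf h = 4 ∧ JIsE8 h} ∧
      c.carrier = {h : OE8 | ∀ x, h.1 (h.1 x) = -x}) := by
  refine ⟨nonempty_embedding, fun h hr ho => ⟨?_, fun hJ φ => ?_, fun hJ => ?_⟩, ?_⟩
  · rcases hr.hasPattern ho with hp | hp | hp
    · exact Or.inr (jIsE8_iff.2 hp.apply_apply)
    · exact Or.inl hp.jIsD4
    · exact Or.inl hp.jIsD4
  · obtain ⟨h₁, hh₁⟩ := exists_extends_hQ₁ φ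
    obtain ⟨h₂, hh₂⟩ := exists_extends_hQ₂ φ
    refine ⟨h₁, h₂, hh₁, hh₂, ?_⟩
    rcases hr.hasPattern ho with hp | hp | hp
    · exact absurd (jIsE8_iff.2 hp.apply_apply) (not_jIsE8_of_jIsD4 hJ)
    · exact Or.inl (hp.isConj (patternNeg_of_extends hh₁))
    · exact Or.inr (hp.isConj (patternNegReflection_of_extends hh₂))
  · have hsq := jIsE8_iff.1 hJ
    refine ⟨fun x hx => ?_, hsq⟩
    have h1 := hsq x
    rw [hx, hx, eq_neg_iff_add_eq_zero, ← two_smul ℤ] at h1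
    exact (smul_eq_zero.1 h1).resolve_left (by norm_num)
  · obtain ⟨g, hg⟩ := exists_patternE8
    have hc : (ConjClasses.mk g).carrier = {h : OE8 | ∀ x, h.1 (h.1 x) = -x} := by
      ext k
      rw [ConjClasses.mem_carrier_iff_mk_eq, ConjClasses.mk_eq_mk_iff_isConj]
      constructor
      · intro hk
        obtain ⟨c, rfl⟩ := isConj_iff.1 hk
        exact PatternE8.apply_apply (hg.of_conj c)
      · intro hk
        exact (patternE8_of_apply_apply hk).isConj hg
    refine ⟨ConjClasses.mk g, ?_, hc⟩
    rw [hc]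
    ext k
    exact ⟨fun hk => ⟨isRootless_of_apply_apply hk, orderOf_of_apply_apply hk, jIsE8_iff.2 hk⟩,
      fun hk => jIsE8_iff.1 hk.2.2⟩
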